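/- **Setting.** For a measurable space $\Omega$ let $\mathcal P(\Omega)$ be the set of probability measures on $\Omega$. For an integer $k\ge 1$ let $\mathcal S^{1/k}(\Omega)$ be the space of $1/k$-th powers of finite signed measures, i.e. the direct limit of the spaces $\{\phi\,\mu^{1/k} : \phi\in L^k(\Omega,\mu)\}$ over all finite measures $\mu$ on $\Omega$ (directed by domination), with the inclusions $\phi\,\mu^{1/k}=\phi\,(d\mu/d\nu)^{1/k}\,\nu^{1/k}$ for $\mu\ll\nu$ and the norm $\|\phi\,\mu^{1/k}\|=\|\phi\|_{L^k(\Omega,\mu)}$; in particular $\mathcal S^1(\Omega)=\mathcal S(\Omega)$ is the space of finite signed measures. Let $\mathcal P^{1/k}(\Omega)=\{\mu^{1/k}:\mu\in\mathcal P(\Omega)\}\subset\mathcal S^{1/k}(\Omega)$ with the induced topology and tangent spaces $$T_{\mu^{1/k}}\mathcal P^{1/k}(\Omega)=\{\phi\,\mu^{1/k} : \phi\in L^k(\Omega,\mu),\ \textstyle\int\phi\,d\mu=0\}.$$ A vector field on $\mathcal P^{1/k}(\Omega)$ is a continuous map $X:\mathcal P^{1/k}(\Omega)\to\mathcal S^{1/k}(\Omega)$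 with $X_{\mu^{1/k}}\in T_{\mu^{1/k}}\mathcal P^{1/k}(\Omega)$. An $n$-tensor on $\mathcal P^{1/k}(\Omega)$ is a collection of $n$-multilinear forms $\Psi_{\mu^{1/k}}$ on the tangent spaces such that $\mu^{1/k}\mapsto\Psi_{\mu^{1/k}}(X^1,\dots,X^n)$ is continuous for all vector fields $X^1,\dots,X^n$. The canonical $n$-tensor on $\mathcal S^{1/n}(\Omega)$ is $$L^n_\Omega(\phi_1\mu^{1/n},\dots,\phi_n\mu^{1/n})=n^n\int_\Omega\phi_1\cdots\phi_n\,d\mu .$$ The Fisher metric $\mathfrak g_F$ on $\mathcal P^{1/2}(\Omega)$ and the Amari–Chentsov tensor $\mathbf T$ on $\mathcal P^{1/3}(\Omega)$ are the restrictions of $L^2_\Omega$ and $L^3_\Omega$ to the tangent spaces. A Markov kernel $K:\Omega\to\mathcal P(\Omega')$ with Markov morphism $K_*\mu(A)=\int K(\omega;A)\,d\mu(\omega)$ is congruent if there is a measurable map $\kappa:\Omega'\to\Omega$ with $\kappa_*K(\omega)=\delta_\omega$ for all $\omega$. Its formal derivative at $\mu^{1/k}$ is $$dK_{1/k}(\phi\,\mu^{1/k})=\frac{d\{K_*(\phi\mu)\}}{d\{K_*\mu\}}\,(K_*\mu)^{1/k}.$$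 A family $(\Theta^n_\Omega)$ of $n$-tensors on $\mathcal P^{1/k}(\Omega)$, one for each measurable space $\Omega$, is congruent if for every congruent Markov kernel $K:\Omega\to\mathcal P(\Omega')$ and all $\mu\in\mathcal P(\Omega)$, $V_1,\dots,V_n\in T_{\mu^{1/k}}\mathcal P^{1/k}(\Omega)$, $$(\Theta^n_{\Omega'})_{(K_*\mu)^{1/k}}(dK_{1/k}V_1,\dots,dK_{1/k}V_n)=(\Theta^n_\Omega)_{\mu^{1/k}}(V_1,\dots,V_n).$$ A $k$-integrable statistical model $(M,\Omega,\mathbf p)$ is a (finite or infinite dimensional) manifold $M$ without boundary with a map $\mathbf p:M\to\mathcal P(\Omega)$ such that $\mathbf p:M\to\mathcal S(\Omega)$ and $\mathbf p^{1/k}:M\to\mathcal S^{1/k}(\Omega)$ are Fréchet differentiable. The Fisher metric of a $2$-integrable model is $\mathfrak g_M=(\mathbf p^{1/2})^*L^2_\Omega$, and the Amari–Chentsov tensor of a $3$-integrable model is $\mathbf T_M=(\mathbf p^{1/3})^*L^3_\Omega$. **Theorem (generalization of Chentsov's theorem).** 1. Let $(\Theta^2_\Omega)$ be a congruent family of $2$-tensors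 on $\mathcal P^{1/2}(\Omega)$. Then there is a constant $c\in\mathbb R$ such that $\Theta^2_\Omega=c\,\mathfrak g_F$ for all measurable spaces $\Omega$. Moreover, with the same $c$, for every $2$-integrable statistical model $(M,\Omega,\mathbf p)$ the differentials $d_\xi\mathbf p^{1/2}(v)$ are tangent to $\mathcal P^{1/2}(\Omega)$ at $\mathbf p(\xi)^{1/2}$, and $(\mathbf p^{1/2})^*\Theta^2_\Omega=c\,\mathfrak g_M$. 2. Let $(\Theta^3_\Omega)$ be a congruent family of $3$-tensors on $\mathcal P^{1/3}(\Omega)$. Then there is a constant $c\in\mathbb R$ such that $\Theta^3_\Omega=c\,\mathbf T$ for all measurable spaces $\Omega$. Moreover, with the same $c$, for every $3$-integrable statistical model $(M,\Omega,\mathbf p)$ the differentials $d_\xi\mathbf p^{1/3}(v)$ are tangent to $\mathcal P^{1/3}(\Omega)$ at $\mathbf p(\xi)^{1/3}$, and $(\mathbf p^{1/3})^*\Theta^3_\Omega=c\,\mathbf T_M$. -/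

import Mathlib

open MeasureTheory ProbabilityTheory
open scoped ENNReal Manifold

universe u v w x

noncomputable section

namespace RootMeasure

instance factOneLeCast (k : ℕ) [NeZero k] : Fact (1 ≤ (k : ℝ≥0∞)) :=
  ⟨by exact_mod_cast Nat.one_le_iff_ne_zero.mpr (NeZero.ne k)⟩

/-- Finite measures on `Ω`, preordered by domination: `μ ≤ ν` means `μ ≪ ν`. -/
structure FinMeasure (Ω : Type u) [MeasurableSpace Ω] where
  val : Measure Ω
  finite : IsFiniteMeasure val

attribute [instance] FinMeasure.finite

section PowersOfMeasures

variable {Ω : Type u} [MeasurableSpace Ω]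

instance : Preorder (FinMeasure Ω) where
  le μ ν := μ.val ≪ ν.val
  le_refl _ := Measure.AbsolutelyContinuous.rfl
  le_trans _ _ _ h h' := h.trans h'

instance : IsDirectedOrder (FinMeasure Ω) :=
  ⟨fun μ ν => ⟨⟨μ.val + ν.val, inferInstance⟩,
    Measure.AbsolutelyContinuous.rfl.add_right _,
    by
      change ν.val ≪ μ.val + ν.val
      rw [add_comm]
      exact Measure.AbsolutelyContinuous.rfl.add_right _⟩⟩

instance : Nonempty (FinMeasure Ω) := ⟨⟨0, inferInstance⟩⟩

/-- If `μ ≪ ν`, then `φ μ^{1/k} = φ (dμ/dν)^{1/k} ν^{1/k}`; this is the new coefficient. -/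
def transFun (k : ℕ) (μ ν : Measure Ω) (φ : Ω → ℝ) (x : Ω) : ℝ :=
  φ x * ((μ.rnDeriv ν x).toReal) ^ ((k : ℝ)⁻¹)

theorem transFun_congr (k : ℕ) [NeZero k] {μ ν : Measure Ω} [IsFiniteMeasure μ]
    [IsFiniteMeasure ν] (h : μ ≪ ν) {φ ψ : Ω → ℝ} (e : φ =ᵐ[μ] ψ) :
    transFun k μ ν φ =ᵐ[ν] transFun k μ ν ψ := by
  have e' : ∀ᵐ x ∂(ν.withDensity (μ.rnDeriv ν)), φ x = ψ x := by
    rw [Measure.withDensity_rnDeriv_eq μ ν h]; exact e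
  rw [ae_withDensity_iff (Measure.measurable_rnDeriv μ ν)] at e'
  filter_upwards [e'] with x hx
  by_cases h0 : μ.rnDeriv ν x = 0
  · have hk : ((k : ℝ)⁻¹) ≠ 0 := inv_ne_zero (Nat.cast_ne_zero.mpr (NeZero.ne k))
    simp [transFun, h0, Real.zero_rpow hk]
  · simp [transFun, hx h0]

theorem eLpNorm_transFun (k : ℕ) [NeZero k] {μ ν : Measure Ω} [IsFiniteMeasure μ]
    [IsFiniteMeasure ν] (h : μ ≪ ν) {φ : Ω → ℝ} (hφ : StronglyMeasurable φ) :
    eLpNorm (transFun k μ ν φ) k ν = eLpNorm φ k μ := by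
  have hk : (k : ℝ≥0∞) ≠ 0 := by exact_mod_cast NeZero.ne k
  have hkR : (k : ℝ) ≠ 0 := Nat.cast_ne_zero.mpr (NeZero.ne k)
  rw [eLpNorm_eq_lintegral_rpow_enorm_toReal hk (ENNReal.natCast_ne_top k),
    eLpNorm_eq_lintegral_rpow_enorm_toReal hk (ENNReal.natCast_ne_top k)]
  congr 1
  rw [← lintegral_rnDeriv_mul h (hφ.measurable.enorm.pow_const _).aemeasurable]
  apply lintegral_congr_ae
  filter_upwards [Measure.rnDeriv_lt_top μ ν] with x hx
  have h1 : ‖((μ.rnDeriv ν x).toReal) ^ ((k : ℝ)⁻¹)‖ₑ = (μ.rnDeriv ν x) ^ ((k : ℝ)⁻¹) := by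
    rw [Real.enorm_eq_ofReal (by positivity),
      ← ENNReal.ofReal_rpow_of_nonneg ENNReal.toReal_nonneg (by positivity),
      ENNReal.ofReal_toReal hx.ne]
  simp only [transFun, enorm_mul, h1, ENNReal.toReal_natCast]
  rw [ENNReal.mul_rpow_of_nonneg _ _ (by positivity), ← ENNReal.rpow_mul,
    inv_mul_cancel₀ hkR, ENNReal.rpow_one, mul_comm]

theorem memLp_transFun (k : ℕ) [NeZero k] {μ ν : Measure Ω} [IsFiniteMeasure μ]
    [IsFiniteMeasure ν] (h : μ ≪ ν) (φ : Lp ℝ k μ) : MemLp (transFun k μ ν φ) k ν := by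
  refine ⟨?_, ?_⟩
  · exact ((Lp.stronglyMeasurable φ).measurable.mul
      ((Measure.measurable_rnDeriv μ ν).ennreal_toReal.pow_const _)).aestronglyMeasurable
  · rw [eLpNorm_transFun k h (Lp.stronglyMeasurable φ)]
    exact Lp.eLpNorm_lt_top φ

/-- The isometric inclusion `S^{1/k}(Ω; μ) → S^{1/k}(Ω; ν)` for `μ ≪ ν`, written on the
coefficients: `φ ↦ φ (dμ/dν)^{1/k}`. -/
def trans (k : ℕ) [NeZero k] (μ ν : FinMeasure Ω) (h : μ ≤ ν) :
    Lp ℝ k μ.val →ₗᵢ[ℝ] Lp ℝ k ν.val where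
  toFun φ := (memLp_transFun k h φ).toLp _
  map_add' φ ψ := by
    rw [← MemLp.toLp_add]
    apply MemLp.toLp_congr
    refine (transFun_congr k h (Lp.coeFn_add φ ψ)).trans (Filter.Eventually.of_forall fun x => ?_)
    simp [transFun, add_mul]
  map_smul' c φ := by
    rw [RingHom.id_apply, ← MemLp.toLp_const_smul]
    apply MemLp.toLp_congr
    refine (transFun_congr k h (Lp.coeFn_smul c φ)).trans (Filter.Eventually.of_forall fun x => ?_)
    simp [transFun, mul_assoc]
  norm_map' φ := by
    change ‖(memLp_transFun k h φ).toLp _‖ = _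
    rw [Lp.norm_toLp, eLpNorm_transFun k h (Lp.stronglyMeasurable φ)]
    rfl

theorem coeFn_trans (k : ℕ) [NeZero k] {μ ν : FinMeasure Ω} (h : μ ≤ ν) (φ : Lp ℝ k μ.val) :
    trans k μ ν h φ =ᵐ[ν.val] transFun k μ.val ν.val φ :=
  MemLp.coeFn_toLp (memLp_transFun k h φ)

instance (k : ℕ) [NeZero k] :
    DirectedSystem (fun μ : FinMeasure Ω => Lp ℝ k μ.val) (trans k · · ·) where
  map_self μ φ := by
    apply Lp.ext
    filter_upwards [coeFn_trans k (le_refl μ) φ, Measure.rnDeriv_self μ.val] with x hx h1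
    rw [hx, transFun, h1]; simp
  map_map μ ν ρ h h' φ := by
    apply Lp.ext
    filter_upwards [coeFn_trans k h' (trans k _ _ h φ), coeFn_trans k (h.trans h') φ,
      transFun_congr k h' (coeFn_trans k h φ),
      Measure.rnDeriv_mul_rnDeriv (κ := μ.val) h] with x h1 h2 h3 h4
    rw [h1, h2, h3, transFun, transFun, transFun, ← h4, Pi.mul_apply, ENNReal.toReal_mul,
      Real.mul_rpow ENNReal.toReal_nonneg ENNReal.toReal_nonneg, mul_assoc]

end PowersOfMeasures

/-- The space `S^{1/k}(Ω)` of `1/k`-th powers of finite signed measures: the direct limit of the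
spaces `S^{1/k}(Ω; μ) = {φ μ^{1/k} | φ ∈ L^k(Ω, μ)}` over all finite measures `μ`, directed by
domination, along the isometric inclusions `φ μ^{1/k} = φ (dμ/dν)^{1/k} ν^{1/k}` for `μ ≪ ν`. -/
def RootSpace (k : ℕ) [NeZero k] (Ω : Type u) [MeasurableSpace Ω] : Type u :=
  DirectLimit (fun μ : FinMeasure Ω => Lp ℝ k μ.val) (trans k)

section RootSpace

variable {k : ℕ} [NeZero k] {Ω : Type u} [MeasurableSpace Ω]

instance : AddCommGroup (RootSpace k Ω) :=
  inferInstanceAs (AddCommGroup (DirectLimit (fun μ : FinMeasure Ω => Lp ℝ k μ.val) (trans k)))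

instance : Module ℝ (RootSpace k Ω) :=
  inferInstanceAs (Module ℝ (DirectLimit (fun μ : FinMeasure Ω => Lp ℝ k μ.val) (trans k)))

/-- The element `φ μ^{1/k}` of `S^{1/k}(Ω)`, linear in `φ ∈ L^k(Ω, μ)`. -/
def dominated (k : ℕ) [NeZero k] (μ : FinMeasure Ω) : Lp ℝ k μ.val →ₗ[ℝ] RootSpace k Ω where
  toFun φ := (⟦⟨μ, φ⟩⟧ : DirectLimit (fun μ : FinMeasure Ω => Lp ℝ k μ.val) (trans k))
  map_add' φ ψ := (DirectLimit.add_def (f := trans k) μ φ ψ).symm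
  map_smul' c φ := (DirectLimit.smul_def (f := trans k) μ φ c).symm

theorem dominated_trans {μ ν : FinMeasure Ω} (h : μ ≤ ν) (φ : Lp ℝ k μ.val) :
    dominated k ν (trans k μ ν h φ) = dominated k μ φ := by
  have e := DirectLimit.eq_of_le (F := fun μ : FinMeasure Ω => Lp ℝ k μ.val) (f := trans k)
    ⟨μ, φ⟩ ν h
  exact e.symm

theorem dominated_injective (μ : FinMeasure Ω) : Function.Injective (dominated k μ) :=
  DirectLimit.mk_injective (trans k) (fun μ ν h => (trans k μ ν h).injective) μ

theorem exists_dominated (x : RootSpace k Ω) : ∃ μ φ, x = dominated k μ φ :=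
  DirectLimit.exists_eq_mk (trans k) x

theorem exists_dominated₂ (x y : RootSpace k Ω) :
    ∃ μ φ ψ, x = dominated k μ φ ∧ y = dominated k μ ψ :=
  DirectLimit.exists_eq_mk₂ (trans k) x y

/-- Finitely many elements of `S^{1/k}(Ω)` are dominated by one finite measure. -/
theorem exists_dominated_family {n : ℕ} (x : Fin n → RootSpace k Ω) :
    ∃ (μ : FinMeasure Ω) (φ : Fin n → Lp ℝ k μ.val), ∀ i, x i = dominated k μ (φ i) := by
  choose ν ψ h using fun i => exists_dominated (x i)
  obtain ⟨μ, hμ⟩ := Finite.exists_le ν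
  exact ⟨μ, fun i => trans k _ _ (hμ i) (ψ i), fun i => by rw [dominated_trans, h]⟩

/-- The norm of `S^{1/k}(Ω)`: the norm of `φ μ^{1/k}` is the `L^k(Ω, μ)`-norm of `φ`. -/
instance : Norm (RootSpace k Ω) where
  norm := DirectLimit.lift (trans k) (fun _ φ => ‖φ‖)
    (fun μ ν h φ => ((trans k μ ν h).norm_map φ).symm)

theorem norm_dominated (μ : FinMeasure Ω) (φ : Lp ℝ k μ.val) : ‖dominated k μ φ‖ = ‖φ‖ := rfl

theorem normCore : NormedSpace.Core ℝ (RootSpace k Ω) where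
  norm_nonneg x := by
    obtain ⟨μ, φ, rfl⟩ := exists_dominated x
    exact norm_nonneg φ
  norm_smul c x := by
    obtain ⟨μ, φ, rfl⟩ := exists_dominated x
    rw [← map_smul, norm_dominated, norm_dominated, norm_smul]
  norm_triangle x y := by
    obtain ⟨μ, φ, ψ, rfl, rfl⟩ := exists_dominated₂ x y
    rw [← map_add, norm_dominated, norm_dominated, norm_dominated]
    exact norm_add_le φ ψ
  norm_eq_zero_iff x := by
    obtain ⟨μ, φ, rfl⟩ := exists_dominated x
    rw [norm_dominated, norm_eq_zero, map_eq_zero_iff _ (dominated_injective μ)]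

instance : NormedAddCommGroup (RootSpace k Ω) := NormedAddCommGroup.ofCore normCore

instance : NormedSpace ℝ (RootSpace k Ω) := NormedSpace.ofCore normCore

end RootSpace

section Probability

variable {Ω : Type u} [MeasurableSpace Ω]

/-- A probability measure, regarded as a finite measure. -/
def toFin (μ : ProbabilityMeasure Ω) : FinMeasure Ω := ⟨μ, inferInstance⟩

instance (μ : ProbabilityMeasure Ω) : IsProbabilityMeasure (toFin μ).val :=
  inferInstanceAs (IsProbabilityMeasure (μ : Measure Ω))

/-- The root `μ^{1/k} ∈ S^{1/k}(Ω)` of a probability measure `μ`. -/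
def root (k : ℕ) [NeZero k] (μ : ProbabilityMeasure Ω) : RootSpace k Ω :=
  dominated k (toFin μ) ((memLp_const (1 : ℝ)).toLp _)

/-- Elements of `L^k(Ω, μ)` have zero mean if their integral over the probability measure `μ`
vanishes. -/
def meanZero (k : ℕ) [NeZero k] (μ : ProbabilityMeasure Ω) :
    Submodule ℝ (Lp ℝ k (toFin μ).val) where
  carrier := {φ | ∫ x, φ x ∂(toFin μ).val = 0}
  zero_mem' := by
    have e := integral_congr_ae (Lp.coeFn_zero ℝ k (toFin μ).val)
    simp only [Pi.zero_apply, integral_zero] at e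
    exact e
  add_mem' {φ ψ} hφ hψ := by
    have e := integral_congr_ae (Lp.coeFn_add φ ψ)
    have hk : (1 : ℝ≥0∞) ≤ k := Fact.out
    simp only [Set.mem_ofPred_eq] at hφ hψ ⊢
    rw [e]
    simp only [Pi.add_apply]
    rw [integral_add ((Lp.memLp φ).integrable hk) ((Lp.memLp ψ).integrable hk), hφ, hψ, add_zero]
  smul_mem' c φ hφ := by
    have e := integral_congr_ae (Lp.coeFn_smul c φ)
    simp only [Set.mem_ofPred_eq] at hφ ⊢
    rw [e]
    simp only [Pi.smul_apply]
    rw [integral_smul, hφ, smul_zero]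

/-- The tangent space of `P^{1/k}(Ω)` at `μ^{1/k}`, namely
`{φ μ^{1/k} | φ ∈ L^k(Ω, μ), E_μ(φ) = 0}`. -/
def tangent (k : ℕ) [NeZero k] (μ : ProbabilityMeasure Ω) : Submodule ℝ (RootSpace k Ω) :=
  (meanZero k μ).map (dominated k (toFin μ))

/-- The isomorphism `φ ↦ φ μ^{1/k}` of the mean zero functions in `L^k(Ω, μ)` with the tangent
space. -/
def tangentEquiv (k : ℕ) [NeZero k] (μ : ProbabilityMeasure Ω) :
    meanZero k μ ≃ₗ[ℝ] tangent k μ :=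
  Submodule.equivMapOfInjective (dominated k (toFin μ)) (dominated_injective _) (meanZero k μ)

/-- Distinct probability measures have distinct roots. -/
theorem root_injective (k : ℕ) [NeZero k] :
    Function.Injective (root k : ProbabilityMeasure Ω → RootSpace k Ω) := by
  intro μ ν h
  obtain ⟨ρ, hμ, hν⟩ := exists_ge_ge (toFin μ) (toFin ν)
  unfold root at h
  rw [← dominated_trans hμ, ← dominated_trans hν] at h
  have e := dominated_injective ρ h
  have hk : ((k : ℝ)⁻¹) ≠ 0 := inv_ne_zero (Nat.cast_ne_zero.mpr (NeZero.ne k))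
  have key : (toFin μ).val.rnDeriv ρ.val =ᵐ[ρ.val] (toFin ν).val.rnDeriv ρ.val := by
    filter_upwards [coeFn_trans k hμ ((memLp_const (1 : ℝ)).toLp _),
      coeFn_trans k hν ((memLp_const (1 : ℝ)).toLp _),
      transFun_congr k hμ (MemLp.coeFn_toLp (memLp_const (p := k) (1 : ℝ))),
      transFun_congr k hν (MemLp.coeFn_toLp (memLp_const (p := k) (1 : ℝ))),
      Measure.rnDeriv_lt_top (toFin μ).val ρ.val, Measure.rnDeriv_lt_top (toFin ν).val ρ.val]
      with x h1 h2 h3 h4 h5 h6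
    have h7 := congrArg (fun f : Lp ℝ k ρ.val => f x) e
    simp only [h1, h2, h3, h4] at h7
    simp only [transFun, one_mul] at h7
    rw [Real.rpow_left_inj ENNReal.toReal_nonneg ENNReal.toReal_nonneg hk] at h7
    exact (ENNReal.toReal_eq_toReal_iff' h5.ne h6.ne).mp h7
  have : (toFin μ).val = (toFin ν).val := by
    rw [← Measure.withDensity_rnDeriv_eq _ _ hμ, ← Measure.withDensity_rnDeriv_eq _ _ hν]
    exact withDensity_congr_ae key
  exact Subtype.ext this

end Probability

/-- The set `P^{1/k}(Ω) ⊆ S^{1/k}(Ω)` of roots of probability measures. The root `μ^{1/k}` is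
recorded by `μ`, and the topology is the one of `S^{1/k}(Ω)`. -/
def ProbRoot (_k : ℕ) (Ω : Type u) [MeasurableSpace Ω] : Type u := ProbabilityMeasure Ω

/-- The probability measure `μ` with root `μ^{1/k}`. -/
def ProbRoot.measure {k : ℕ} {Ω : Type u} [MeasurableSpace Ω] (μ : ProbRoot k Ω) :
    ProbabilityMeasure Ω := μ

section TensorFields

variable (k : ℕ) [NeZero k] (Ω : Type u) [MeasurableSpace Ω]

instance : TopologicalSpace (ProbRoot k Ω) :=
  TopologicalSpace.induced (fun μ => root k μ.measure) inferInstance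

/-- A (continuous) vector field on `P^{1/k}(Ω)`. -/
structure VectorField where
  toFun : ProbRoot k Ω → RootSpace k Ω
  continuous_toFun : Continuous toFun
  mem_tangent : ∀ μ, toFun μ ∈ tangent k μ.measure

/-- A covariant `n`-tensor field on `P^{1/k}(Ω)`: an `n`-multilinear form on each tangent space,
such that inserting continuous vector fields always gives a continuous function. -/
structure TensorField (n : ℕ) where
  form : ∀ μ : ProbabilityMeasure Ω, MultilinearMap ℝ (fun _ : Fin n => tangent k μ) ℝ
  continuous_form : ∀ X : Fin n → VectorField k Ω,
    Continuous fun μ : ProbRoot k Ω =>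
      form μ.measure fun j => ⟨(X j).toFun μ, (X j).mem_tangent μ⟩

end TensorFields

section Markov

variable {Ω : Type u} [MeasurableSpace Ω] {Ω' : Type v} [MeasurableSpace Ω']

/-- The Markov morphism `K_* : S(Ω) → S(Ω')` on finite signed measures,
`(K_* s)(A) = ∫ K(ω; A) ds(ω)`, the integral being the difference of the integrals over the
positive and the negative part of `s`. -/
def markovMorphism (K : Kernel Ω Ω') [IsMarkovKernel K] (s : SignedMeasure Ω) :
    SignedMeasure Ω' :=
  (K ∘ₘ s.toJordanDecomposition.posPart).toSignedMeasure -
    (K ∘ₘ s.toJordanDecomposition.negPart).toSignedMeasure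

/-- `K` is congruent if some statistic `κ : Ω' → Ω` satisfies `κ_* K(ω) = δ_ω` for all `ω`. -/
def IsCongruent (K : Kernel Ω Ω') : Prop :=
  ∃ κ : Ω' → Ω, Measurable κ ∧ ∀ ω, (K ω).map κ = Measure.dirac ω

theorem markovMorphism_sub (K : Kernel Ω Ω') [IsMarkovKernel K] (a b : Measure Ω)
    [IsFiniteMeasure a] [IsFiniteMeasure b] :
    markovMorphism K (a.toSignedMeasure - b.toSignedMeasure) =
      (K ∘ₘ a).toSignedMeasure - (K ∘ₘ b).toSignedMeasure := by
  generalize hs : a.toSignedMeasure - b.toSignedMeasure = s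
  have h1 : s.toJordanDecomposition.posPart.toSignedMeasure -
      s.toJordanDecomposition.negPart.toSignedMeasure = s :=
    s.toSignedMeasure_toJordanDecomposition
  have h2 : (s.toJordanDecomposition.posPart + b).toSignedMeasure =
      (a + s.toJordanDecomposition.negPart).toSignedMeasure := by
    rw [Measure.toSignedMeasure_add, Measure.toSignedMeasure_add]
    exact sub_eq_sub_iff_add_eq_add.mp (h1.trans hs.symm)
  have h3 := Measure.toSignedMeasure_eq_toSignedMeasure_iff.mp h2
  have h4 : (K ∘ₘ s.toJordanDecomposition.posPart) + (K ∘ₘ b) =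
      (K ∘ₘ a) + (K ∘ₘ s.toJordanDecomposition.negPart) := by
    rw [← Measure.comp_add, ← Measure.comp_add, h3]
  have h5 := Measure.toSignedMeasure_eq_toSignedMeasure_iff.mpr h4
  rw [Measure.toSignedMeasure_add, Measure.toSignedMeasure_add] at h5
  exact sub_eq_sub_iff_add_eq_add.mpr h5

theorem markovMorphism_withDensity (K : Kernel Ω Ω') [IsMarkovKernel K] (μ : Measure Ω)
    [IsFiniteMeasure μ] {φ : Ω → ℝ} (hm : Measurable φ) (hφ : Integrable φ μ) {A : Set Ω'}
    (hA : MeasurableSet A) :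
    markovMorphism K (μ.withDensityᵥ φ) A = ∫ ω, φ ω * (K ω).real A ∂μ := by
  have fa := isFiniteMeasure_withDensity_ofReal hφ.2
  have fb := isFiniteMeasure_withDensity_ofReal hφ.neg.2
  have hK : Measurable fun ω => K ω A := Kernel.measurable_coe K hA
  have aux : ∀ ψ : Ω → ℝ, Measurable ψ →
      (K ∘ₘ (μ.withDensity fun x => ENNReal.ofReal (ψ x))) A =
        ∫⁻ ω, ENNReal.ofReal (ψ ω * (K ω).real A) ∂μ := by
    intro ψ hψ
    rw [Measure.bind_apply hA K.aemeasurable,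
      lintegral_withDensity_eq_lintegral_mul _ hψ.ennreal_ofReal hK]
    refine lintegral_congr fun ω => ?_
    rw [Pi.mul_apply, mul_comm (ψ ω), ENNReal.ofReal_mul measureReal_nonneg,
      ofReal_measureReal, mul_comm]
  have hint : Integrable (fun ω => φ ω * (K ω).real A) μ := by
    refine hφ.mono (hm.mul hK.ennreal_toReal).aestronglyMeasurable
      (Filter.Eventually.of_forall fun ω => ?_)
    rw [norm_mul, Real.norm_of_nonneg measureReal_nonneg]
    exact mul_le_of_le_one_right (norm_nonneg _) measureReal_le_one
  have e := withDensityᵥ_eq_withDensity_pos_part_sub_withDensity_neg_part hφ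
  rw [e]
  have e2 := markovMorphism_sub K (μ.withDensity fun x => ENNReal.ofReal (φ x))
    (μ.withDensity fun x => ENNReal.ofReal (-φ x))
  rw [e2, integral_eq_lintegral_pos_part_sub_lintegral_neg_part hint, Measure.toSignedMeasure_sub_apply hA]
  simp only [measureReal_def, ← neg_mul]
  rw [aux φ hm, aux (fun x => -φ x) hm.neg]
  rfl

/-- The Radon-Nikodym derivative `d{K_*(φ μ)} / d{K_* μ}`. -/
def kernelDensity (K : Kernel Ω Ω') [IsMarkovKernel K] (μ : Measure Ω) (φ : Ω → ℝ) : Ω' → ℝ :=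
  (markovMorphism K (μ.withDensityᵥ φ)).rnDeriv (K ∘ₘ μ)

theorem withDensity_kernelDensity (K : Kernel Ω Ω') [IsMarkovKernel K] (μ : Measure Ω)
    [IsFiniteMeasure μ] {φ : Ω → ℝ} (hm : Measurable φ) (hφ : Integrable φ μ) :
    (K ∘ₘ μ).withDensityᵥ (kernelDensity K μ φ) = markovMorphism K (μ.withDensityᵥ φ) := by
  apply SignedMeasure.withDensityᵥ_rnDeriv_eq
  refine VectorMeasure.AbsolutelyContinuous.mk fun A hA h => ?_
  rw [Measure.toENNRealVectorMeasure_apply_measurable hA, Measure.bind_apply hA K.aemeasurable,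
    lintegral_eq_zero_iff (Kernel.measurable_coe K hA)] at h
  rw [markovMorphism_withDensity K μ hm hφ hA]
  apply integral_eq_zero_of_ae
  filter_upwards [h] with ω hω
  simp [measureReal_def, hω]

theorem integrable_kernelDensity (K : Kernel Ω Ω') [IsMarkovKernel K] (μ : Measure Ω)
    (φ : Ω → ℝ) : Integrable (kernelDensity K μ φ) (K ∘ₘ μ) :=
  SignedMeasure.integrable_rnDeriv _ _

theorem setIntegral_kernelDensity (K : Kernel Ω Ω') [IsMarkovKernel K] (μ : Measure Ω)
    [IsFiniteMeasure μ] {φ : Ω → ℝ} (hm : Measurable φ) (hφ : Integrable φ μ) {A : Set Ω'}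
    (hA : MeasurableSet A) :
    ∫ y in A, kernelDensity K μ φ y ∂(K ∘ₘ μ) = ∫ ω, φ ω * (K ω).real A ∂μ := by
  rw [← withDensityᵥ_apply (integrable_kernelDensity K μ φ) hA,
    withDensity_kernelDensity K μ hm hφ, markovMorphism_withDensity K μ hm hφ hA]

theorem integrable_mul_kernel (K : Kernel Ω Ω') [IsMarkovKernel K] (μ : Measure Ω)
    {φ : Ω → ℝ} (hφ : Integrable φ μ) {A : Set Ω'} (hA : MeasurableSet A) :
    Integrable (fun ω => φ ω * (K ω).real A) μ := by
  refine hφ.mono (hφ.1.mul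
    (Kernel.measurable_coe K hA).ennreal_toReal.aestronglyMeasurable)
    (Filter.Eventually.of_forall fun ω => ?_)
  rw [norm_mul, Real.norm_of_nonneg measureReal_nonneg]
  exact mul_le_of_le_one_right (norm_nonneg _) measureReal_le_one

theorem memLp_kernelDensity (K : Kernel Ω Ω') [IsMarkovKernel K] (μ : Measure Ω)
    [IsFiniteMeasure μ] {φ : Ω → ℝ} (hm : Measurable φ) {p : ℝ≥0∞} (hp : 1 ≤ p)
    (hφ : MemLp φ p μ) : MemLp (kernelDensity K μ φ) p (K ∘ₘ μ) := by
  have hi : Integrable φ μ := hφ.integrable hp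
  set g := kernelDensity K μ φ with hg
  have gm : Measurable g := SignedMeasure.measurable_rnDeriv _ _
  have gi : Integrable g (K ∘ₘ μ) := SignedMeasure.integrable_rnDeriv _ _
  have hsnd : (μ ⊗ₘ K).map Prod.snd = K ∘ₘ μ := Measure.snd_compProd μ K
  have hfst : (μ ⊗ₘ K).map Prod.fst = μ := Measure.fst_compProd μ K
  have hF : MemLp (fun z : Ω × Ω' => φ z.1) p (μ ⊗ₘ K) := by
    rw [← hfst] at hφ
    exact (memLp_map_measure_iff hm.aestronglyMeasurable measurable_fst.aemeasurable).mp hφ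
  have hFi := hF.integrable hp
  have hGi : Integrable (fun z : Ω × Ω' => g z.2) (μ ⊗ₘ K) := by
    rw [← hsnd] at gi
    exact (integrable_map_measure gm.aestronglyMeasurable measurable_snd.aemeasurable).mp gi
  have hle : MeasurableSpace.comap (Prod.snd : Ω × Ω' → Ω') inferInstance ≤
      (inferInstance : MeasurableSpace (Ω × Ω')) := measurable_snd.comap_le
  have key : (fun z : Ω × Ω' => g z.2) =ᵐ[μ ⊗ₘ K]
      (μ ⊗ₘ K)[fun z => φ z.1 | MeasurableSpace.comap Prod.snd inferInstance] := by
    refine ae_eq_condExp_of_forall_setIntegral_eq hle hFi (fun s _ _ => hGi.integrableOn) ?_ ?_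
    · rintro s ⟨A, hA, rfl⟩ -
      have e1 : ∫ z in Prod.snd ⁻¹' A, g z.2 ∂(μ ⊗ₘ K) = ∫ y in A, g y ∂(K ∘ₘ μ) := by
        rw [← hsnd, setIntegral_map hA gm.aestronglyMeasurable measurable_snd.aemeasurable]
      have e2 : ∫ z in Prod.snd ⁻¹' A, φ z.1 ∂(μ ⊗ₘ K) = ∫ ω, φ ω * (K ω).real A ∂μ := by
        rw [← Set.univ_prod, Measure.setIntegral_compProd MeasurableSet.univ hA hFi.integrableOn]
        simp [mul_comm]
      rw [e1, e2, ← withDensityᵥ_apply gi hA, hg, withDensity_kernelDensity K μ hm hi,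
        markovMorphism_withDensity K μ hm hi hA]
    · exact (gm.comp (comap_measurable _)).aestronglyMeasurable
  have hG : MemLp (fun z : Ω × Ω' => g z.2) p (μ ⊗ₘ K) :=
    (memLp_congr_ae key).mpr (hF.condExp hp)
  rw [← hsnd]
  exact (memLp_map_measure_iff gm.aestronglyMeasurable measurable_snd.aemeasurable).mpr hG

/-- The image `K_* μ` of a probability measure. -/
def push (K : Kernel Ω Ω') [IsMarkovKernel K] (μ : ProbabilityMeasure Ω) :
    ProbabilityMeasure Ω' := ⟨K ∘ₘ (μ : Measure Ω), inferInstance⟩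

variable {k : ℕ} [NeZero k]

theorem integrable_coe {μ : FinMeasure Ω} (φ : Lp ℝ k μ.val) : Integrable φ μ.val :=
  (Lp.memLp φ).integrable Fact.out

theorem memLp_kernelDensity_coe (K : Kernel Ω Ω') [IsMarkovKernel K] (μ : ProbabilityMeasure Ω)
    (φ : Lp ℝ k (toFin μ).val) :
    MemLp (kernelDensity K (toFin μ).val φ) k (toFin (push K μ)).val :=
  memLp_kernelDensity K (toFin μ).val (Lp.stronglyMeasurable φ).measurable Fact.out (Lp.memLp φ)

/-- The map `L^k(Ω, μ) → L^k(Ω', K_* μ)`, `φ ↦ d{K_*(φ μ)} / d{K_* μ}`. -/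
def densityMap (K : Kernel Ω Ω') [IsMarkovKernel K] (μ : ProbabilityMeasure Ω) :
    Lp ℝ k (toFin μ).val →ₗ[ℝ] Lp ℝ k (toFin (push K μ)).val where
  toFun φ := (memLp_kernelDensity_coe K μ φ).toLp _
  map_add' φ ψ := by
    rw [← MemLp.toLp_add]
    apply MemLp.toLp_congr
    have hi := fun φ : Lp ℝ k (toFin μ).val => integrable_kernelDensity K (toFin μ).val φ
    refine Integrable.ae_eq_of_forall_setIntegral_eq _ _ (hi _) ((hi _).add (hi _))
      fun A hA _ => ?_
    have hS := fun φ : Lp ℝ k (toFin μ).val => setIntegral_kernelDensity K (toFin μ).val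
      (Lp.stronglyMeasurable φ).measurable (integrable_coe φ) hA
    have hM := fun φ : Lp ℝ k (toFin μ).val =>
      integrable_mul_kernel K (toFin μ).val (integrable_coe φ) hA
    have e2 : ∫ y in A, (kernelDensity K (toFin μ).val φ + kernelDensity K (toFin μ).val ψ) y
        ∂(K ∘ₘ (toFin μ).val) = _ := integral_add (hi φ).integrableOn (hi ψ).integrableOn
    refine (hS _).trans (Eq.trans ?_ e2.symm)
    rw [hS, hS, ← integral_add (hM φ) (hM ψ)]
    apply integral_congr_ae
    filter_upwards [Lp.coeFn_add φ ψ] with ω hω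
    rw [hω, Pi.add_apply, add_mul]
  map_smul' c φ := by
    rw [RingHom.id_apply, ← MemLp.toLp_const_smul]
    apply MemLp.toLp_congr
    have hi := fun φ : Lp ℝ k (toFin μ).val => integrable_kernelDensity K (toFin μ).val φ
    refine Integrable.ae_eq_of_forall_setIntegral_eq _ _ (hi _) ((hi _).smul c)
      fun A hA _ => ?_
    have hS := fun φ : Lp ℝ k (toFin μ).val => setIntegral_kernelDensity K (toFin μ).val
      (Lp.stronglyMeasurable φ).measurable (integrable_coe φ) hA
    have e2 : ∫ y in A, (c • kernelDensity K (toFin μ).val φ) y ∂(K ∘ₘ (toFin μ).val) = _ :=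
      integral_smul c _
    refine (hS _).trans (Eq.trans ?_ e2.symm)
    rw [hS, smul_eq_mul, ← integral_const_mul]
    apply integral_congr_ae
    filter_upwards [Lp.coeFn_smul c φ] with ω hω
    rw [hω, Pi.smul_apply, smul_eq_mul, mul_assoc]

theorem densityMap_mem (K : Kernel Ω Ω') [IsMarkovKernel K] (μ : ProbabilityMeasure Ω)
    (φ : Lp ℝ k (toFin μ).val) (hφ : φ ∈ meanZero k μ) :
    densityMap K μ φ ∈ meanZero k (push K μ) := by
  have e := integral_congr_ae (MemLp.coeFn_toLp (memLp_kernelDensity_coe K μ φ))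
  have h := setIntegral_kernelDensity K (toFin μ).val
    (Lp.stronglyMeasurable φ).measurable (integrable_coe φ) MeasurableSet.univ
  simp only [Measure.restrict_univ, probReal_univ, mul_one] at h
  exact e.trans (h.trans hφ)

/-- The formal derivative `d_{μ^{1/k}} K_{1/k}` of `K_{1/k}` on the tangent space of `P^{1/k}(Ω)`:
`φ μ^{1/k} ↦ (d{K_*(φ μ)} / d{K_* μ}) (K_* μ)^{1/k}`. -/
def formalDeriv (k : ℕ) [NeZero k] (K : Kernel Ω Ω') [IsMarkovKernel K]
    (μ : ProbabilityMeasure Ω) : tangent k μ →ₗ[ℝ] tangent k (push K μ) :=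
  (tangentEquiv k (push K μ)).toLinearMap ∘ₗ
    ((densityMap K μ).restrict (densityMap_mem K μ)) ∘ₗ (tangentEquiv k μ).symm.toLinearMap

/-- The pullback `K_{1/k}^* Ψ` of a tensor field on `P^{1/k}(Ω')`, a multilinear form on each
tangent space of `P^{1/k}(Ω)`. -/
def markovPullback {n : ℕ} (K : Kernel Ω Ω') [IsMarkovKernel K] (Ψ : TensorField k Ω' n)
    (μ : ProbabilityMeasure Ω) : MultilinearMap ℝ (fun _ : Fin n => tangent k μ) ℝ :=
  (Ψ.form (push K μ)).compLinearMap fun _ => formalDeriv k K μ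

end Markov

section Canonical

/-- The canonical `n`-tensor `L^n(ν_1, …, ν_n) = n^n ∫ d(ν_1 ⋯ ν_n)` on `S^{1/n}(Ω)`. If
`ν_i = φ_i μ^{1/n}` for a finite measure `μ`, then `ν_1 ⋯ ν_n = φ_1 ⋯ φ_n μ`; the value does not
depend on the choice of `μ`, see `canonicalForm_dominated`. -/
def canonicalForm {Ω : Type u} [MeasurableSpace Ω] (n : ℕ) [NeZero n]
    (ν : Fin n → RootSpace n Ω) : ℝ :=
  (n : ℝ) ^ n * ∫ x, ∏ i, (exists_dominated_family ν).choose_spec.choose i x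
    ∂(exists_dominated_family ν).choose.val

theorem integral_prod_trans {Ω : Type u} [MeasurableSpace Ω] {n : ℕ} [NeZero n]
    {μ ρ : FinMeasure Ω} (h : μ ≤ ρ) (φ : Fin n → Lp ℝ n μ.val) :
    ∫ x, ∏ i, (trans n μ ρ h (φ i)) x ∂ρ.val = ∫ x, ∏ i, φ i x ∂μ.val := by
  rw [← integral_rnDeriv_smul h]
  apply integral_congr_ae
  have hall : ∀ᵐ x ∂ρ.val, ∀ i, (trans n μ ρ h (φ i)) x = transFun n μ.val ρ.val (φ i) x :=
    ae_all_iff.mpr fun i => coeFn_trans n h (φ i)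
  filter_upwards [hall] with x hx
  simp only [hx, transFun, Finset.prod_mul_distrib, Finset.prod_const, Finset.card_univ,
    Fintype.card_fin, smul_eq_mul]
  rw [← Real.rpow_natCast, ← Real.rpow_mul ENNReal.toReal_nonneg,
    inv_mul_cancel₀ (Nat.cast_ne_zero.mpr (NeZero.ne n)), Real.rpow_one, mul_comm]

theorem canonicalForm_dominated {Ω : Type u} [MeasurableSpace Ω] {n : ℕ} [NeZero n]
    (μ : FinMeasure Ω) (φ : Fin n → Lp ℝ n μ.val) :
    canonicalForm n (fun i => dominated n μ (φ i)) = (n : ℝ) ^ n * ∫ x, ∏ i, φ i x ∂μ.val := by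
  have hs := (exists_dominated_family fun i => dominated n μ (φ i)).choose_spec.choose_spec
  unfold canonicalForm
  set σ := (exists_dominated_family fun i => dominated n μ (φ i)).choose
  set ψ := (exists_dominated_family fun i => dominated n μ (φ i)).choose_spec.choose
  obtain ⟨ρ, h1, h2⟩ := exists_ge_ge σ μ
  rw [← integral_prod_trans h1 ψ, ← integral_prod_trans h2 φ]
  have e : ∀ i, trans n _ _ h1 (ψ i) = trans n _ _ h2 (φ i) := fun i => by
    apply dominated_injective ρ
    rw [dominated_trans, dominated_trans]
    exact (hs i).symm
  simp only [e]

/-- The Fisher metric on `P^{1/2}(Ω)`, `g_μ(φ_1 μ^{1/2}, φ_2 μ^{1/2}) = 4 ∫ φ_1 φ_2 dμ`. -/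
def fisherMetric {Ω : Type u} [MeasurableSpace Ω] (μ : ProbabilityMeasure Ω)
    (V : Fin 2 → tangent 2 μ) : ℝ :=
  canonicalForm 2 fun j => (V j : RootSpace 2 Ω)

/-- The Amari-Chentsov tensor on `P^{1/3}(Ω)`,
`T_μ(φ_1 μ^{1/3}, φ_2 μ^{1/3}, φ_3 μ^{1/3}) = 27 ∫ φ_1 φ_2 φ_3 dμ`. -/
def amariChentsov {Ω : Type u} [MeasurableSpace Ω] (μ : ProbabilityMeasure Ω)
    (V : Fin 3 → tangent 3 μ) : ℝ :=
  canonicalForm 3 fun j => (V j : RootSpace 3 Ω)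

end Canonical

/-- A congruent family of `n`-tensors on the spaces `P^{1/k}(Ω)`. -/
def IsCongruentFamily {k : ℕ} [NeZero k] {n : ℕ}
    (Θ : ∀ (Ω : Type u) [MeasurableSpace Ω], TensorField k Ω n) : Prop :=
  ∀ (Ω Ω' : Type u) [MeasurableSpace Ω] [MeasurableSpace Ω'] (K : Kernel Ω Ω') [IsMarkovKernel K],
    IsCongruent K → ∀ μ : ProbabilityMeasure Ω, markovPullback K (Θ Ω') μ = (Θ Ω).form μ

section Models

variable {Ω : Type u} [MeasurableSpace Ω]
  {E : Type*} [NormedAddCommGroup E] [NormedSpace ℝ E] {H : Type*} [TopologicalSpace H]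
  (I : ModelWithCorners ℝ E H) {M : Type*} [TopologicalSpace M] [ChartedSpace H M]

/-- A `k`-integrable statistical model: `p : M → P(Ω)` is Fréchet differentiable as a map into
`S(Ω) = S^{1/1}(Ω)`, and `p^{1/k}` is Fréchet differentiable as a map into `S^{1/k}(Ω)`. -/
structure IsIntegrableModel (k : ℕ) [NeZero k] (p : M → ProbabilityMeasure Ω) : Prop where
  mdifferentiable : MDifferentiable I 𝓘(ℝ, RootSpace 1 Ω) fun ξ => root 1 (p ξ)
  mdifferentiable_root : MDifferentiable I 𝓘(ℝ, RootSpace k Ω) fun ξ => root k (p ξ)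

/-- The differential `d_ξ p^{1/k} : T_ξ M → S^{1/k}(Ω)`. -/
def rootDeriv (k : ℕ) [NeZero k] (p : M → ProbabilityMeasure Ω) (ξ : M) :
    TangentSpace I ξ →ₗ[ℝ] RootSpace k Ω :=
  (mfderiv I 𝓘(ℝ, RootSpace k Ω) (fun η => root k (p η)) ξ).toLinearMap

/-- The pullback `(p^{1/k})^* Ψ` of a tensor field on `P^{1/k}(Ω)`, for `p^{1/k}` with differentials
tangent to `P^{1/k}(Ω)`. -/
def modelPullback {k : ℕ} [NeZero k] {n : ℕ} (p : M → ProbabilityMeasure Ω)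
    (h : ∀ ξ v, rootDeriv I k p ξ v ∈ tangent k (p ξ)) (Ψ : TensorField k Ω n) (ξ : M) :
    MultilinearMap ℝ (fun _ : Fin n => TangentSpace I ξ) ℝ :=
  (Ψ.form (p ξ)).compLinearMap fun _ => (rootDeriv I k p ξ).codRestrict _ (h ξ)

/-- The canonical `n`-tensor `(p^{1/n})^* L^n` of a model. For `n = 2` it is the Fisher metric of
the model, for `n = 3` the Amari-Chentsov tensor of the model. -/
def modelTensor (n : ℕ) [NeZero n] (p : M → ProbabilityMeasure Ω) (ξ : M)
    (v : Fin n → TangentSpace I ξ) : ℝ :=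
  canonicalForm n fun j => rootDeriv I n p ξ (v j)

end Models

end RootMeasure

end

/-! Congruence transports a tensor between a measure and its images. If `κ : Ω → J` is a surjective
statistic with finitely many values, the conditional distributions of `μ` on the fibres form a
congruent kernel that carries `κ_* μ` back to `μ` (`fibreKernel_comp`), and its formal derivative is
composition with `κ` (`kernelDensity_of_congruent`). So on step vectors `(s - E_μ(s)) μ^{1/n}`, with
`s` simple, `Θ` is determined by its values over finite sets (`form_comp_stepTangent`).

Over a finite set with the uniform distribution, relabelling makes the form permutation invariant. A
coefficient then depends only on which of its indices coincide, that is, on a partition of the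
slots, and on mean zero functions a partition with a singleton block contributes nothing. For `n =
2, 3` only the one-block partition survives, so the form is a multiple of `∑ ∏ f_i`
(`bilinear_of_perm_invariant`, `trilinear_of_perm_invariant`). Projecting a product onto its factors
shows that the multiple is the same for all finite sets. Images of uniform distributions give all
positive rational weights; continuity then gives all measures on finite sets, hence all step vectors
over every `Ω` (`agreesOnStep`).

The passage to arbitrary tangent vectors needs care: the forms are not assumed continuous on a
tangent space, only along continuous vector fields. Each vector at `μ` is therefore extended to a
field whose value at every other point is a step vector (`exists_vectorField`). The identity holds
away from `μ` and passes to the limit, since a nonzero tangent vector at `μ` prevents `μ^{1/n}` from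
being isolated (`mem_closure_compl_singleton`).

For models the main point is tangency (`rootDeriv_mem_tangent`). Functionals that are nonnegative on
roots and vanish at `p(ξ)^{1/n}` are minimal there, so they kill the differential; this forces
domination by `p(ξ)`. Constancy of `L^n(x, …, x)` on roots gives mean zero. -/

noncomputable section

namespace RootMeasure

/-! ### The canonical tensor is multilinear and continuous -/

section CanonicalForm

theorem prod_update_apply {Ω : Type u} [MeasurableSpace Ω] {n : ℕ}
    {μ : FinMeasure Ω} (φ : Fin n → Lp ℝ n μ.val) (i : Fin n) (ψ : Lp ℝ n μ.val) (x : Ω) :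
    ∏ j, (Function.update φ i ψ j) x = ψ x * ∏ j ∈ Finset.univ \ {i}, φ j x := by
  rw [← Finset.prod_update_of_mem (Finset.mem_univ i)]
  refine Finset.prod_congr rfl fun j _ => ?_
  by_cases h : j = i
  · subst h; simp
  · simp [h]

variable {Ω : Type u} [MeasurableSpace Ω] {n : ℕ} [NeZero n]

theorem memLp_prod {μ : Measure Ω} {φ : Fin n → Ω → ℝ} (hφ : ∀ i, MemLp (φ i) n μ) :
    MemLp (fun x => ∏ i, φ i x) 1 μ := by
  have h := MemLp.prod' (s := Finset.univ) (p := fun _ => (n : ℝ≥0∞)) (fun i _ => hφ i)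
  have e : (∑ _i : Fin n, ((n : ℝ≥0∞))⁻¹)⁻¹ = 1 := by
    rw [Finset.sum_const, Finset.card_univ, Fintype.card_fin, nsmul_eq_mul,
      ENNReal.mul_inv_cancel (by exact_mod_cast NeZero.ne n) (ENNReal.natCast_ne_top n), inv_one]
  rwa [e] at h

theorem integrable_prod_coe {μ : FinMeasure Ω} (φ : Fin n → Lp ℝ n μ.val) :
    Integrable (fun x => ∏ i, φ i x) μ.val :=
  memLp_one_iff_integrable.mp (memLp_prod fun i => Lp.memLp (φ i))

/-- Hölder's inequality with `n` equal weights `1/n`, applied to the functions `|φ_i|^n`. -/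
theorem norm_integral_prod_le {μ : FinMeasure Ω} (φ : Fin n → Lp ℝ n μ.val) :
    ‖∫ x, ∏ i, φ i x ∂μ.val‖ ≤ ∏ i, ‖φ i‖ := by
  have hn : (n : ℝ) ≠ 0 := Nat.cast_ne_zero.mpr (NeZero.ne n)
  have hn' : (n : ℝ≥0∞) ≠ 0 := by exact_mod_cast NeZero.ne n
  have h := ENNReal.lintegral_prod_norm_pow_le (μ := μ.val) (Finset.univ : Finset (Fin n))
    (f := fun i x => ‖φ i x‖ₑ ^ (n : ℝ)) (p := fun _ => (n : ℝ)⁻¹)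
    (fun i _ => (Lp.stronglyMeasurable (φ i)).measurable.enorm.pow_const _ |>.aemeasurable)
    (by simp [hn]) (fun _ _ => by positivity)
  have e : ∀ i, (∫⁻ x, ‖φ i x‖ₑ ^ (n : ℝ) ∂μ.val) ^ ((n : ℝ)⁻¹) = ‖φ i‖ₑ := fun i => by
    rw [Lp.enorm_def, eLpNorm_eq_lintegral_rpow_enorm_toReal hn' (ENNReal.natCast_ne_top n)]
    simp
  simp only [e, ← ENNReal.rpow_mul, mul_inv_cancel₀ hn, ENNReal.rpow_one] at h
  rw [← toReal_enorm]
  have h2 : ‖∫ x, ∏ i, φ i x ∂μ.val‖ₑ ≤ ∏ i, ‖φ i‖ₑ := by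
    refine (enorm_integral_le_lintegral_enorm _).trans (le_trans (le_of_eq ?_) h)
    refine lintegral_congr fun x => ?_
    simp [enorm_eq_nnnorm, nnnorm_prod]
  refine (ENNReal.toReal_mono (ENNReal.prod_ne_top fun _ _ => enorm_ne_top) h2).trans
    (le_of_eq ?_)
  simp [ENNReal.toReal_prod]

theorem update_dominated {μ : FinMeasure Ω} (φ : Fin n → Lp ℝ n μ.val) (i : Fin n)
    (ψ : Lp ℝ n μ.val) :
    Function.update (fun j => dominated n μ (φ j)) i (dominated n μ ψ) =
      fun j => dominated n μ (Function.update φ i ψ j) := by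
  funext j
  by_cases h : j = i
  · subst h; simp
  · simp [h]

variable (n Ω) in
/-- The canonical `n`-tensor as a continuous multilinear form. -/
def canonicalMultilinear : ContinuousMultilinearMap ℝ (fun _ : Fin n => RootSpace n Ω) ℝ :=
  MultilinearMap.mkContinuous
    { toFun := canonicalForm n
      map_update_add' := by
        intro inst m i a b
        have : inst = instDecidableEqFin n := Subsingleton.elim _ _
        subst this
        -- The two summands are put in front of the family so that one finite measure dominates all
        -- `n + 2` vectors at once.
        obtain ⟨μ, φ, hφ⟩ := exists_dominated_family (Fin.cons a (Fin.cons b m) :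
          Fin (n + 1 + 1) → RootSpace n Ω)
        have ha := hφ 0
        have hb := hφ 1
        have hm : m = fun j => dominated n μ (φ j.succ.succ) := funext fun j => hφ j.succ.succ
        simp only [Fin.cons_zero] at ha
        replace hb : b = dominated n μ (φ 1) := hb
        subst ha hb hm
        rw [← map_add]
        simp only [update_dominated, canonicalForm_dominated]
        rw [← mul_add, ← integral_add (integrable_prod_coe _) (integrable_prod_coe _)]
        congr 1
        apply integral_congr_ae
        filter_upwards [Lp.coeFn_add (φ 0) (φ 1)] with x hx
        simp only [prod_update_apply, hx, Pi.add_apply, add_mul]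
      map_update_smul' := by
        intro inst m i c a
        have : inst = instDecidableEqFin n := Subsingleton.elim _ _
        subst this
        obtain ⟨μ, φ, hφ⟩ := exists_dominated_family (Fin.cons a m :
          Fin (n + 1) → RootSpace n Ω)
        have ha := hφ 0
        have hm : m = fun j => dominated n μ (φ j.succ) := funext fun j => hφ j.succ
        simp only [Fin.cons_zero] at ha
        subst ha hm
        rw [← map_smul]
        simp only [update_dominated, canonicalForm_dominated]
        rw [smul_eq_mul, mul_left_comm, ← integral_const_mul c]
        congr 1
        apply integral_congr_ae
        filter_upwards [Lp.coeFn_smul c (φ 0)] with x hx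
        simp only [prod_update_apply, hx, Pi.smul_apply, smul_eq_mul, mul_assoc] }
    ((n : ℝ) ^ n) (fun m => by
      obtain ⟨μ, φ, hφ⟩ := exists_dominated_family m
      obtain rfl : m = fun j => dominated n μ (φ j) := funext hφ
      change ‖canonicalForm n _‖ ≤ _
      rw [canonicalForm_dominated, norm_mul, Real.norm_of_nonneg (by positivity)]
      exact mul_le_mul_of_nonneg_left (norm_integral_prod_le φ) (by positivity))

theorem canonicalMultilinear_apply (v : Fin n → RootSpace n Ω) :
    canonicalMultilinear Ω n v = canonicalForm n v := rfl

end CanonicalForm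

/-! ### Change of dominating measure -/

section Coefficients

variable {k : ℕ} [NeZero k] {Ω : Type u} [MeasurableSpace Ω]

theorem dominated_toLp {μ ν : FinMeasure Ω} (h : μ ≤ ν) {f : Ω → ℝ} (hf : MemLp f k μ.val)
    {g : Ω → ℝ} (hg : MemLp g k ν.val) (e : g =ᵐ[ν.val] transFun k μ.val ν.val f) :
    dominated k μ (hf.toLp f) = dominated k ν (hg.toLp g) := by
  rw [← dominated_trans h]
  congr 1
  apply Lp.ext
  filter_upwards [coeFn_trans k h (hf.toLp f), transFun_congr k h hf.coeFn_toLp,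
    hg.coeFn_toLp, e] with x h1 h2 h3 h4
  rw [h1, h2, h3, h4]

/-- If `dν = g^k dμ` with `g ≥ 0`, then `ν^{1/k} = g μ^{1/k}`. -/
theorem root_eq_dominated (ν : ProbabilityMeasure Ω) (μ : FinMeasure Ω) {g : Ω → ℝ}
    (hm : Measurable g) (h0 : ∀ x, 0 ≤ g x)
    (hν : (ν : Measure Ω) = μ.val.withDensity fun x => ENNReal.ofReal (g x ^ k))
    (hg : MemLp g k μ.val) :
    root k ν = dominated k μ (hg.toLp g) := by
  have hk : (k : ℝ) ≠ 0 := Nat.cast_ne_zero.mpr (NeZero.ne k)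
  have hle : toFin ν ≤ μ := by
    change (ν : Measure Ω) ≪ μ.val
    rw [hν]; exact withDensity_absolutelyContinuous _ _
  refine dominated_toLp hle _ hg ?_
  have := Measure.rnDeriv_withDensity μ.val (hm.pow_const k).ennreal_ofReal
  rw [← hν] at this
  filter_upwards [this] with x hx
  change g x = 1 * ((ν : Measure Ω).rnDeriv μ.val x).toReal ^ ((k : ℝ)⁻¹)
  rw [hx, ENNReal.toReal_ofReal (pow_nonneg (h0 x) k), one_mul, ← Real.rpow_natCast,
    ← Real.rpow_mul (h0 x), mul_inv_cancel₀ hk, Real.rpow_one]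

end Coefficients

/-! ### Step vectors and step fields -/

section Step

variable {Ω : Type u} [MeasurableSpace Ω] {n : ℕ} [NeZero n]

theorem root_coeFn {n : ℕ} (μ : ProbabilityMeasure Ω) :
    (((memLp_const (1 : ℝ)).toLp _ : Lp ℝ n (toFin μ).val) : Ω → ℝ) =ᵐ[(toFin μ).val] fun _ => 1 :=
  MemLp.coeFn_toLp _

/-- With `μ^{1/n}` in all other slots the canonical tensor becomes `n^n E_μ`. This expresses means
through a continuous multilinear form, and so gives their continuity in `μ` as well as in the
vector. -/
theorem canonicalForm_update_root (μ : ProbabilityMeasure Ω) (i : Fin n)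
    (φ : Lp ℝ n (toFin μ).val) :
    canonicalForm n (Function.update (fun _ => root n μ) i (dominated n (toFin μ) φ)) =
      (n : ℝ) ^ n * ∫ x, φ x ∂(toFin μ).val := by
  unfold root
  rw [update_dominated (fun _ : Fin n => (memLp_const (1 : ℝ)).toLp _) i φ,
    canonicalForm_dominated]
  congr 1
  apply integral_congr_ae
  filter_upwards [root_coeFn (n := n) μ] with x hx
  rw [prod_update_apply]
  simp only [hx, Finset.prod_const_one, mul_one]

theorem canonicalForm_root (μ : ProbabilityMeasure Ω) :
    canonicalForm n (fun _ => root n μ) = (n : ℝ) ^ n := by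
  have h := canonicalForm_update_root (n := n) μ 0 ((memLp_const (1 : ℝ)).toLp _)
  change canonicalForm n (Function.update (fun _ => root n μ) 0 (root n μ)) = _ at h
  have e := integral_congr_ae (root_coeFn (n := n) μ)
  rw [Function.update_eq_self (0 : Fin n) (fun _ => root n μ), e] at h
  simpa using h

variable (n) in
/-- The functional `φ ρ^{1/n} ↦ ∫ φ dμ` at `μ = ρ`, extended continuously to `S^{1/n}(Ω)`. -/
def meanAt (μ : ProbabilityMeasure Ω) (x : RootSpace n Ω) : ℝ :=
  ((n : ℝ) ^ n)⁻¹ * canonicalForm n (Function.update (fun _ => root n μ) 0 x)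

theorem meanAt_dominated (μ : ProbabilityMeasure Ω) (φ : Lp ℝ n (toFin μ).val) :
    meanAt n μ (dominated n (toFin μ) φ) = ∫ x, φ x ∂(toFin μ).val := by
  have hn : ((n : ℝ) ^ n) ≠ 0 := pow_ne_zero _ (Nat.cast_ne_zero.mpr (NeZero.ne n))
  rw [meanAt, canonicalForm_update_root, inv_mul_cancel_left₀ hn]

theorem continuous_root : Continuous fun μ : ProbRoot n Ω => root n μ.measure :=
  continuous_induced_dom

theorem continuous_meanAt {X : Type*} [TopologicalSpace X] {p : X → ProbRoot n Ω}
    (hp : Continuous p) {F : X → RootSpace n Ω} (hF : Continuous F) :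
    Continuous fun t => meanAt n (p t).measure (F t) := by
  refine continuous_const.mul ((canonicalMultilinear Ω n).cont.comp
    ((continuous_pi fun _ => continuous_root.comp hp).update 0 hF))

variable (n) in
/-- The class in `L^n(Ω, μ)` of a simple function. -/
def simpleLp (μ : FinMeasure Ω) : SimpleFunc Ω ℝ →ₗ[ℝ] Lp ℝ n μ.val where
  toFun s := (s.memLp_of_isFiniteMeasure n μ.val).toLp s
  map_add' _ _ := rfl
  map_smul' _ _ := rfl

theorem coeFn_simpleLp {n : ℕ} (μ : FinMeasure Ω) (s : SimpleFunc Ω ℝ) :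
    simpleLp n μ s =ᵐ[μ.val] s :=
  MemLp.coeFn_toLp (s.memLp_of_isFiniteMeasure n μ.val)

theorem dominated_simpleLp_sub_const (μ : ProbabilityMeasure Ω) (s : SimpleFunc Ω ℝ) (c : ℝ) :
    dominated n (toFin μ) (simpleLp n _ (s - SimpleFunc.const Ω c)) =
      dominated n (toFin μ) (simpleLp n _ s) - c • root n μ := by
  rw [map_sub, map_sub]
  change _ = _ - c • dominated n (toFin μ) _
  rw [← map_smul]
  congr 2
  apply Lp.ext
  filter_upwards [coeFn_simpleLp (n := n) (toFin μ) (SimpleFunc.const Ω c),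
    root_coeFn (n := n) μ,
    Lp.coeFn_smul c ((memLp_const (1 : ℝ)).toLp _ : Lp ℝ n (toFin μ).val)] with x h1 h2 h3
  rw [h1, h3, Pi.smul_apply, h2]
  simp

variable (n) in
/-- The tangent vector `(s - E_μ(s)) μ^{1/n}` of a simple function `s`. -/
def stepTangent (μ : ProbabilityMeasure Ω) : SimpleFunc Ω ℝ →ₗ[ℝ] tangent n μ :=
  LinearMap.codRestrict (tangent n μ)
    { toFun := fun s => dominated n (toFin μ) (simpleLp n _ s) -
        (∫ x, s x ∂(μ : Measure Ω)) • root n μ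
      map_add' := fun s t => by
        simp only [SimpleFunc.coe_add, Pi.add_apply, map_add]
        rw [integral_add (s.integrable_of_isFiniteMeasure) (t.integrable_of_isFiniteMeasure)]
        module
      map_smul' := fun c s => by
        simp only [SimpleFunc.coe_smul, Pi.smul_apply, map_smul, RingHom.id_apply]
        rw [integral_smul]
        module }
    (fun s => by
      refine ⟨simpleLp n (toFin μ) (s - SimpleFunc.const Ω (∫ x, s x ∂(μ : Measure Ω))), ?_,
        dominated_simpleLp_sub_const μ s _⟩
      refine (integral_congr_ae (coeFn_simpleLp (toFin μ) _)).trans ?_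
      change ∫ x, (s x - (∫ x, s x ∂(μ : Measure Ω))) ∂(μ : Measure Ω) = 0
      rw [integral_sub s.integrable_of_isFiniteMeasure (integrable_const _)]
      simp)

theorem coe_stepTangent (μ : ProbabilityMeasure Ω) (s : SimpleFunc Ω ℝ) :
    (stepTangent n μ s : RootSpace n Ω) = dominated n (toFin μ) (simpleLp n _ s) -
      (∫ x, s x ∂(μ : Measure Ω)) • root n μ := rfl

theorem coe_stepTangent' (μ : ProbabilityMeasure Ω) (s : SimpleFunc Ω ℝ) :
    (stepTangent n μ s : RootSpace n Ω) = dominated n (toFin μ)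
      (simpleLp n _ (s - SimpleFunc.const Ω (∫ x, s x ∂(μ : Measure Ω)))) :=
  (dominated_simpleLp_sub_const μ s _).symm

/-- Over a common dominating measure the coefficient of `s μ^{1/n}` is `s` times that of `μ^{1/n}`,
and multiplication by a function bounded by `C` has norm at most `C`. -/
theorem norm_dominated_simpleLp_sub_le (s : SimpleFunc Ω ℝ) {C : ℝ} (hC : ∀ x, ‖s x‖ ≤ C)
    (μ ν : ProbabilityMeasure Ω) :
    ‖dominated n (toFin μ) (simpleLp n _ s) - dominated n (toFin ν) (simpleLp n _ s)‖ ≤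
      C * ‖root n μ - root n ν‖ := by
  obtain ⟨ρ, hμ, hν⟩ := exists_ge_ge (toFin μ) (toFin ν)
  have key : ∀ σ : ProbabilityMeasure Ω, ∀ hσ : toFin σ ≤ ρ,
      trans n _ _ hσ (simpleLp n _ s) =ᵐ[ρ.val]
        fun x => s x * (trans n _ _ hσ ((memLp_const (1 : ℝ)).toLp _)) x := fun σ hσ => by
    filter_upwards [coeFn_trans n hσ (simpleLp n (toFin σ) s),
      transFun_congr n hσ (coeFn_simpleLp (n := n) (toFin σ) s),
      coeFn_trans n hσ ((memLp_const (1 : ℝ)).toLp _),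
      transFun_congr n hσ (root_coeFn (n := n) σ)] with x h1 h2 h3 h4
    rw [h1, h2, h3, h4, transFun, transFun, one_mul]
  unfold root
  rw [← dominated_trans hμ, ← dominated_trans hν, ← dominated_trans hμ, ← dominated_trans hν,
    ← map_sub, ← map_sub, norm_dominated, norm_dominated]
  apply Lp.norm_le_mul_norm_of_ae_le_mul
  filter_upwards [key μ hμ, key ν hν, Lp.coeFn_sub (trans n _ _ hμ (simpleLp n _ s))
    (trans n _ _ hν (simpleLp n _ s)), Lp.coeFn_sub
    (trans n _ _ hμ ((memLp_const (1 : ℝ)).toLp _ : Lp ℝ n (toFin μ).val))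
    (trans n _ _ hν ((memLp_const (1 : ℝ)).toLp _ : Lp ℝ n (toFin ν).val))] with x h1 h2 h3 h4
  rw [h3, h4, Pi.sub_apply, Pi.sub_apply, h1, h2, ← mul_sub, norm_mul]
  exact mul_le_mul_of_nonneg_right (hC x) (norm_nonneg _)

theorem continuous_dominated_simpleLp (s : SimpleFunc Ω ℝ) :
    Continuous fun μ : ProbRoot n Ω => dominated n (toFin μ.measure) (simpleLp n _ s) := by
  obtain ⟨C, hC⟩ := s.exists_forall_norm_le
  refine continuous_iff_continuousAt.mpr fun ν => tendsto_iff_norm_sub_tendsto_zero.mpr ?_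
  have h := ((continuous_root (n := n) (Ω := Ω)).sub
    (continuous_const (y := root n ν.measure))).norm.const_mul C
  refine squeeze_zero (fun _ => norm_nonneg _)
    (fun μ => norm_dominated_simpleLp_sub_le s hC μ.measure ν.measure) ?_
  simpa using h.tendsto ν

theorem continuous_stepTangent (s : SimpleFunc Ω ℝ) :
    Continuous fun μ : ProbRoot n Ω => (stepTangent n μ.measure s : RootSpace n Ω) := by
  have h : Continuous fun μ : ProbRoot n Ω => ∫ x, s x ∂(μ.measure : Measure Ω) := ?_
  · exact (continuous_dominated_simpleLp s).sub (h.smul continuous_root)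
  refine (continuous_meanAt continuous_id (continuous_dominated_simpleLp (n := n) s)).congr
    fun μ => ?_
  rw [id, meanAt_dominated]
  exact integral_congr_ae (coeFn_simpleLp _ s)

variable (n) in
/-- The vector field `μ^{1/n} ↦ (s - E_μ(s)) μ^{1/n}` of a simple function `s`. -/
def stepField (s : SimpleFunc Ω ℝ) : VectorField n Ω where
  toFun μ := stepTangent n μ.measure s
  continuous_toFun := continuous_stepTangent s
  mem_tangent μ := (stepTangent n μ.measure s).2

/-- Simple functions are dense in `L^n(Ω, μ)`, and the centring map `P` is continuous and fixes
vectors of mean zero. -/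
theorem mem_closure_range_stepTangent (μ : ProbabilityMeasure Ω) (V : tangent n μ) :
    (V : RootSpace n Ω) ∈
      closure (Set.range fun s => (stepTangent n μ s : RootSpace n Ω)) := by
  obtain ⟨_, φ, hφ, rfl⟩ := V
  let P : Lp ℝ n (toFin μ).val → RootSpace n Ω := fun φ =>
    dominated n (toFin μ) φ - (meanAt n μ (dominated n (toFin μ) φ)) • root n μ
  have hd : Continuous (dominated n (toFin μ)) :=
    (AddMonoidHomClass.isometry_of_norm _ (norm_dominated (toFin μ))).continuous
  have hm : Continuous fun φ => meanAt n μ (dominated n (toFin μ) φ) :=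
    continuous_meanAt (p := fun _ => (μ : ProbRoot n Ω)) continuous_const hd
  have hP : Continuous P := hd.sub (hm.smul (continuous_const (y := root n μ)))
  have hφ' : φ ∈ closure (Set.range (simpleLp n (toFin μ))) := by
    rw [EMetric.mem_closure_iff]
    intro ε hε
    obtain ⟨g, hg, hg'⟩ := (Lp.memLp φ).exists_simpleFunc_eLpNorm_sub_lt
      (ENNReal.natCast_ne_top n) hε.ne'
    refine ⟨_, ⟨g, rfl⟩, ?_⟩
    rw [Lp.edist_def]
    refine lt_of_le_of_lt (le_of_eq (eLpNorm_congr_ae ?_)) hg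
    filter_upwards [coeFn_simpleLp (n := n) (toFin μ) g] with x hx
    simp [hx]
  have h := image_closure_subset_closure_image hP ⟨φ, hφ', rfl⟩
  have e : P φ = dominated n (toFin μ) φ := by
    have : ∫ x, φ x ∂(toFin μ).val = 0 := hφ
    simp only [P, meanAt_dominated, this, zero_smul, sub_zero]
  rw [e, ← Set.range_comp] at h
  convert h using 3
  funext s
  simp only [P, Function.comp_apply, meanAt_dominated, coe_stepTangent]
  rw [integral_congr_ae (coeFn_simpleLp (toFin μ) s)]
  rfl

end Step

/-! ### Congruent kernels act by composition with the statistic -/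

section CongruentKernel

variable {Ω : Type u} [MeasurableSpace Ω] {Ω' : Type v} [MeasurableSpace Ω']

theorem map_comp_of_congruent {K : Kernel Ω Ω'} [IsMarkovKernel K] {κ : Ω' → Ω}
    (hκ : Measurable κ) (hK : ∀ ω, (K ω).map κ = Measure.dirac ω) (μ : Measure Ω) :
    (K ∘ₘ μ).map κ = μ := by
  rw [Measure.map_comp _ _ hκ]
  have : K.map κ = Kernel.id := by
    ext1 ω
    rw [Kernel.map_apply _ hκ, hK, Kernel.id_apply]
  rw [this, Measure.id_comp]

theorem comp_ae_eq_of_congruent {K : Kernel Ω Ω'} {κ : Ω' → Ω}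
    (hκ : Measurable κ) (hK : ∀ ω, (K ω).map κ = Measure.dirac ω) {φ : Ω → ℝ}
    (hφ : Measurable φ) (ω : Ω) : ∀ᵐ y ∂(K ω), φ (κ y) = φ ω := by
  have hm : MeasurableSet {x | φ x = φ ω} := hφ (measurableSet_singleton (φ ω))
  have h : ∀ᵐ x ∂(K ω).map κ, φ x = φ ω := by
    rw [hK, ae_dirac_iff hm]
  exact (ae_map_iff hκ.aemeasurable hm).mp h

theorem integral_kernel_comp (K : Kernel Ω Ω') [IsMarkovKernel K] (μ : Measure Ω)
    [IsFiniteMeasure μ] {f : Ω' → ℝ} (hf : Integrable f (K ∘ₘ μ)) :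
    ∫ y, f y ∂(K ∘ₘ μ) = ∫ ω, ∫ y, f y ∂K ω ∂μ := by
  rw [← Measure.snd_compProd μ K, Measure.snd] at hf ⊢
  rw [integral_map measurable_snd.aemeasurable hf.1]
  exact Measure.integral_compProd (hf.comp_measurable measurable_snd)

/-- For a congruent kernel, `d{K_*(φ μ)} / d{K_* μ} = φ ∘ κ`. -/
theorem kernelDensity_of_congruent {K : Kernel Ω Ω'} [IsMarkovKernel K] {κ : Ω' → Ω}
    (hκ : Measurable κ) (hK : ∀ ω, (K ω).map κ = Measure.dirac ω) (μ : Measure Ω)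
    [IsFiniteMeasure μ] {φ : Ω → ℝ} (hm : Measurable φ) (hφ : Integrable φ μ) :
    kernelDensity K μ φ =ᵐ[K ∘ₘ μ] φ ∘ κ := by
  have hi : Integrable (φ ∘ κ) (K ∘ₘ μ) := by
    rw [← integrable_map_measure hm.aestronglyMeasurable hκ.aemeasurable,
      map_comp_of_congruent hκ hK]
    exact hφ
  refine Integrable.ae_eq_of_forall_setIntegral_eq _ _ (integrable_kernelDensity K μ φ) hi
    fun A hA _ => ?_
  rw [setIntegral_kernelDensity K μ hm hφ hA, ← integral_indicator hA,
    integral_kernel_comp K μ (hi.indicator hA)]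
  refine integral_congr_ae (Filter.Eventually.of_forall fun ω => ?_)
  change φ ω * (K ω).real A = ∫ y, A.indicator (φ ∘ κ) y ∂K ω
  rw [integral_indicator hA]
  have e : ∫ y in A, (φ ∘ κ) y ∂K ω = ∫ y in A, φ ω ∂K ω :=
    integral_congr_ae (ae_restrict_of_ae (comp_ae_eq_of_congruent hκ hK hm ω))
  rw [e, setIntegral_const, smul_eq_mul, mul_comm]

variable {n : ℕ} [NeZero n]

theorem coe_formalDeriv (K : Kernel Ω Ω') [IsMarkovKernel K] (μ : ProbabilityMeasure Ω)
    (V : tangent n μ) {φ : Lp ℝ n (toFin μ).val} (hV : (V : RootSpace n Ω) = dominated n _ φ) :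
    (formalDeriv n K μ V : RootSpace n Ω') = dominated n (toFin (push K μ)) (densityMap K μ φ) := by
  obtain ⟨W, rfl⟩ := (tangentEquiv n μ).surjective V
  have : (W : Lp ℝ n (toFin μ).val) = φ := dominated_injective _ hV
  subst this
  simp only [formalDeriv, LinearMap.comp_apply, LinearEquiv.coe_coe, LinearEquiv.symm_apply_apply]
  rfl

/-- The density of `K_*(φ μ)` is `φ ∘ κ`, and centring commutes with this because `κ_* K_* μ = μ`.
-/
theorem formalDeriv_stepTangent {K : Kernel Ω Ω'} [IsMarkovKernel K] {κ : Ω' → Ω}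
    (hκ : Measurable κ) (hK : ∀ ω, (K ω).map κ = Measure.dirac ω) (μ : ProbabilityMeasure Ω)
    (s : SimpleFunc Ω ℝ) :
    formalDeriv n K μ (stepTangent n μ s) = stepTangent n (push K μ) (s.comp κ hκ) := by
  apply Subtype.ext
  rw [coe_formalDeriv K μ _ (coe_stepTangent' μ s), coe_stepTangent']
  congr 1
  apply Lp.ext
  have hmap : (K ∘ₘ (μ : Measure Ω)).map κ = μ := map_comp_of_congruent hκ hK _
  set t := s - SimpleFunc.const Ω (∫ x, s x ∂(μ : Measure Ω)) with ht
  have h1 : densityMap K μ (simpleLp n _ t) =ᵐ[(toFin (push K μ)).val]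
      (simpleLp n (toFin μ) t) ∘ κ :=
    (MemLp.coeFn_toLp (memLp_kernelDensity_coe K μ _)).trans
      (kernelDensity_of_congruent hκ hK _ (Lp.stronglyMeasurable _).measurable (integrable_coe _))
  have h2 : (simpleLp n (toFin μ) t) ∘ κ =ᵐ[K ∘ₘ (μ : Measure Ω)] t ∘ κ := by
    refine ae_eq_comp hκ.aemeasurable ?_
    rw [hmap]
    exact coeFn_simpleLp (toFin μ) t
  have h3 : ∫ x, s.comp κ hκ x ∂(push K μ : Measure Ω') = ∫ x, s x ∂(μ : Measure Ω) := by
    conv_rhs => rw [← hmap]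
    exact (integral_map hκ.aemeasurable s.aestronglyMeasurable).symm
  refine (h1.trans h2).trans (Filter.EventuallyEq.trans (Filter.Eventually.of_forall fun y => ?_)
    (coeFn_simpleLp (toFin (push K μ)) _).symm)
  rw [h3]
  rfl

theorem form_push_stepTangent {Ω Ω' : Type u} [MeasurableSpace Ω] [MeasurableSpace Ω']
    {Θ : ∀ (Ω : Type u) [MeasurableSpace Ω], TensorField n Ω n} (hΘ : IsCongruentFamily Θ)
    {K : Kernel Ω Ω'} [IsMarkovKernel K] {κ : Ω' → Ω}
    (hκ : Measurable κ) (hK : ∀ ω, (K ω).map κ = Measure.dirac ω) (μ : ProbabilityMeasure Ω)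
    (s : Fin n → SimpleFunc Ω ℝ) :
    (Θ Ω').form (push K μ) (fun i => stepTangent n _ ((s i).comp κ hκ)) =
      (Θ Ω).form μ fun i => stepTangent n μ (s i) := by
  rw [← hΘ Ω Ω' K ⟨κ, hκ, hK⟩ μ]
  simp only [markovPullback, MultilinearMap.compLinearMap_apply, formalDeriv_stepTangent hκ hK]

end CongruentKernel

/-! ### Reduction to finite sets by conditioning on fibres -/

section FiniteStatistic

variable {Ω : Type u} [MeasurableSpace Ω] {J : Type u} [Finite J] [MeasurableSpace J]
  [MeasurableSingletonClass J]

open scoped Classical in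
/-- The conditional distributions on the fibres of a surjective statistic with finitely many
values; on null fibres a point mass is chosen. -/
def fibreKernel (μ : Measure Ω) {κ : Ω → J} (hs : Function.Surjective κ) : Kernel J Ω :=
  Kernel.ofFunOfCountable fun j =>
    if μ (κ ⁻¹' {j}) = 0 then Measure.dirac (Function.surjInv hs j) else μ[|κ ⁻¹' {j}]

variable (μ : Measure Ω) {κ : Ω → J} (hs : Function.Surjective κ)

theorem fibreKernel_apply_null {j : J} (h : μ (κ ⁻¹' {j}) = 0) :
    fibreKernel μ hs j = Measure.dirac (Function.surjInv hs j) := if_pos h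

theorem fibreKernel_apply {j : J} (h : μ (κ ⁻¹' {j}) ≠ 0) :
    fibreKernel μ hs j = μ[|κ ⁻¹' {j}] := if_neg h

variable [IsProbabilityMeasure μ]

instance isMarkovKernel_fibreKernel : IsMarkovKernel (fibreKernel μ hs) := by
  refine ⟨fun j => ?_⟩
  by_cases h : μ (κ ⁻¹' {j}) = 0
  · rw [fibreKernel_apply_null μ hs h]; infer_instance
  · rw [fibreKernel_apply μ hs h]; exact cond_isProbabilityMeasure h

theorem fibreKernel_congruent (hκ : Measurable κ) (j : J) :
    (fibreKernel μ hs j).map κ = Measure.dirac j := by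
  have hj : MeasurableSet (κ ⁻¹' {j}) := hκ (measurableSet_singleton j)
  by_cases h : μ (κ ⁻¹' {j}) = 0
  · rw [fibreKernel_apply_null μ hs h, Measure.map_dirac' hκ, Function.surjInv_eq hs]
  · rw [fibreKernel_apply μ hs h]
    have := cond_isProbabilityMeasure h
    have hae : κ =ᵐ[μ[|κ ⁻¹' {j}]] fun _ => j := by
      filter_upwards [ae_cond_mem hj] with x hx using hx
    rw [Measure.map_congr hae, Measure.map_const, measure_univ, one_smul]

/-- The law of total probability. Null fibres have weight zero, so the point mass chosen there is
harmless. -/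
theorem fibreKernel_comp (hκ : Measurable κ) : fibreKernel μ hs ∘ₘ μ.map κ = μ := by
  have := Fintype.ofFinite J
  have hj : ∀ j, MeasurableSet (κ ⁻¹' {j}) := fun j => hκ (measurableSet_singleton j)
  ext A hA
  rw [Measure.bind_apply hA (Kernel.aemeasurable _), lintegral_fintype]
  have e : ∀ j, fibreKernel μ hs j A * (μ.map κ) {j} = μ (A ∩ κ ⁻¹' {j}) := fun j => by
    rw [Measure.map_apply hκ (measurableSet_singleton j)]
    by_cases h : μ (κ ⁻¹' {j}) = 0
    · rw [h, mul_zero, measure_mono_null Set.inter_subset_right h]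
    · rw [fibreKernel_apply μ hs h, Set.inter_comm, cond_mul_eq_inter (hj j)]
  simp only [e]
  rw [← tsum_fintype (L := .unconditional J), ← measure_iUnion₀ ?_
    fun j => (hA.inter (hj j)).nullMeasurableSet]
  rotate_left
  · intro i j hij
    refine Disjoint.aedisjoint (Set.disjoint_left.mpr ?_)
    rintro x ⟨_, rfl⟩ ⟨_, h⟩
    exact hij h
  congr 1
  ext x; simp

/-- The fibre kernel is congruent and carries `κ_* μ` back to `μ`, so congruence computes `Θ` on
functions of `κ` inside the finite set `J`. -/
theorem form_comp_stepTangent {n : ℕ} [NeZero n]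
    {Θ : ∀ (Ω : Type u) [MeasurableSpace Ω], TensorField n Ω n} (hΘ : IsCongruentFamily Θ)
    (μ : ProbabilityMeasure Ω) {κ : Ω → J} (hκ : Measurable κ) (hs : Function.Surjective κ)
    (s : Fin n → SimpleFunc J ℝ) :
    (Θ Ω).form μ (fun i => stepTangent n μ ((s i).comp κ hκ)) =
      (Θ J).form (μ.map hκ.aemeasurable) fun i => stepTangent n _ (s i) := by
  have h := form_push_stepTangent hΘ hκ (fibreKernel_congruent (μ : Measure Ω) hs hκ)
    (μ.map hκ.aemeasurable) s
  have e : push (fibreKernel (μ : Measure Ω) hs) (μ.map hκ.aemeasurable) = μ :=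
    Subtype.ext (fibreKernel_comp (μ : Measure Ω) hs hκ)
  rw [e] at h
  exact h

theorem canonicalForm_stepTangent {n : ℕ} [NeZero n] (μ : ProbabilityMeasure Ω)
    (s : Fin n → SimpleFunc Ω ℝ) :
    canonicalForm n (fun i => (stepTangent n μ (s i) : RootSpace n Ω)) =
      (n : ℝ) ^ n * ∫ x, ∏ i, (s i x - ∫ y, s i y ∂(μ : Measure Ω)) ∂(μ : Measure Ω) := by
  simp only [coe_stepTangent']
  rw [canonicalForm_dominated]
  congr 1
  apply integral_congr_ae
  have hall := ae_all_iff.mpr fun i => coeFn_simpleLp (n := n) (toFin μ)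
    (s i - SimpleFunc.const Ω (∫ x, s i x ∂(μ : Measure Ω)))
  filter_upwards [hall] with x hx
  simp only [hx]
  rfl

theorem canonicalForm_comp_stepTangent {J : Type u} [MeasurableSpace J] {n : ℕ} [NeZero n]
    (μ : ProbabilityMeasure Ω) {κ : Ω → J} (hκ : Measurable κ) (s : Fin n → SimpleFunc J ℝ) :
    canonicalForm n (fun i => (stepTangent n μ ((s i).comp κ hκ) : RootSpace n Ω)) =
      canonicalForm n
        fun i => (stepTangent n (μ.map hκ.aemeasurable) (s i) : RootSpace n J) := by
  rw [canonicalForm_stepTangent, canonicalForm_stepTangent]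
  have e : ∀ i, ∫ y, s i y ∂(μ.map hκ.aemeasurable : Measure J) =
      ∫ y, s i (κ y) ∂(μ : Measure Ω) := fun i =>
    integral_map hκ.aemeasurable (s i).aestronglyMeasurable
  simp only [e]
  congr 1
  refine (integral_map (f := fun x => ∏ i, (s i x - ∫ y, s i (κ y) ∂(μ : Measure Ω)))
    hκ.aemeasurable ?_).symm
  exact (Finset.measurable_fun_prod _ fun i _ =>
    (s i).measurable.sub_const _).aestronglyMeasurable

end FiniteStatistic

/-! ### Permutation invariant forms on functions of mean zero -/

section PermInvariant

/-- The map `p` encodes which indices coincide. Two injections of `Fin m` into a finite set differ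
by a permutation, so there is one value for each pattern; if there is no injection, any value
serves. -/
theorem exists_const_of_perm_invariant {J : Type*} [Finite J] {n m : ℕ} {T : (Fin n → J) → ℝ}
    (hT : ∀ (σ : Equiv.Perm J) x, T (σ ∘ x) = T x) (p : Fin n → Fin m) :
    ∃ t, ∀ y : Fin m → J, Function.Injective y → T (y ∘ p) = t := by
  by_cases h : ∃ y : Fin m → J, Function.Injective y
  · obtain ⟨y₀, h₀⟩ := h
    refine ⟨T (y₀ ∘ p), fun y hy => ?_⟩
    obtain ⟨σ, hσ⟩ := Equiv.Perm.exists_extending_pair y₀ y h₀ hy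
    rw [← hT σ (y₀ ∘ p), ← Function.comp_assoc, show σ ∘ y₀ = y from funext hσ]
  · exact ⟨0, fun y hy => (h ⟨y, hy⟩).elim⟩

variable {J : Type*} [Fintype J]

theorem sum_fin_two_arrow (F : (Fin 2 → J) → ℝ) : ∑ x, F x = ∑ i, ∑ j, F ![i, j] := by
  rw [← Fintype.sum_prod_type']
  exact Fintype.sum_equiv (finTwoArrowEquiv J) _ _ fun x => by
    congr 1; funext i; fin_cases i <;> rfl

theorem sum_fin_three_arrow (F : (Fin 3 → J) → ℝ) :
    ∑ x, F x = ∑ i, ∑ j, ∑ k, F ![i, j, k] := by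
  have e : ∀ i, ∑ j, ∑ k, F ![i, j, k] = ∑ p : J × J, F ![i, p.1, p.2] := fun i =>
    (Fintype.sum_prod_type' _).symm
  simp only [e]
  rw [← Fintype.sum_prod_type' (f := fun i (p : J × J) => F ![i, p.1, p.2])]
  refine (Fintype.sum_equiv ⟨fun p : J × J × J => ![p.1, p.2.1, p.2.2],
    fun x => (x 0, x 1, x 2), fun _ => rfl, fun x => ?_⟩ _ _ fun _ => rfl).symm
  funext i; fin_cases i <;> rfl

theorem perm_invariant_single {J : Type*} [DecidableEq J] {n : ℕ}
    (M : MultilinearMap ℝ (fun _ : Fin n => J → ℝ) ℝ)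
    (hM : ∀ (σ : Equiv.Perm J) (f : Fin n → J → ℝ), M (fun i => f i ∘ σ) = M f) (σ : Equiv.Perm J) (x : Fin n → J) :
    (M fun i => Pi.single ((σ ∘ x) i) 1) = M fun i => Pi.single (x i) 1 := by
  rw [← hM σ]
  congr 1
  funext i j
  simp [Pi.single_apply, Function.comp_apply]

variable [DecidableEq J] {n : ℕ} (M : MultilinearMap ℝ (fun _ : Fin n => J → ℝ) ℝ)

theorem multilinear_eq_sum (f : Fin n → J → ℝ) :
    M f = ∑ x : Fin n → J, (∏ i, f i (x i)) * M fun i => Pi.single (x i) 1 := by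
  have e : f = fun i => ∑ j, f i j • (Pi.single j (1 : ℝ) : J → ℝ) := by
    funext i; exact pi_eq_sum_univ' (f i)
  conv_lhs => rw [e]
  rw [MultilinearMap.map_sum]
  exact Finset.sum_congr rfl fun x _ => by
    rw [MultilinearMap.map_smul_univ M (fun i => f i (x i)), smul_eq_mul]

theorem bilinear_of_perm_invariant (M : MultilinearMap ℝ (fun _ : Fin 2 => J → ℝ) ℝ)
    (hM : ∀ (σ : Equiv.Perm J) (f : Fin 2 → J → ℝ), M (fun i => f i ∘ σ) = M f) :
    ∃ d, ∀ f : Fin 2 → J → ℝ, (∀ i, ∑ j, f i j = 0) → M f = d * ∑ j, ∏ i, f i j := by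
  obtain ⟨a, ha⟩ := exists_const_of_perm_invariant (T := fun x => M fun i => Pi.single (x i) 1)
    (perm_invariant_single M hM)     (![0, 0] : Fin 2 → Fin 1)
  obtain ⟨b, hb⟩ := exists_const_of_perm_invariant (T := fun x => M fun i => Pi.single (x i) 1)
    (perm_invariant_single M hM)     (![0, 1] : Fin 2 → Fin 2)
  -- The matrix of `M` has a single diagonal entry `a` and a single off-diagonal entry `b`; its
  -- constant part `b` vanishes on mean zero functions.
  have key : ∀ i j : J, (M fun l => Pi.single (![i, j] l) 1) =
      b + if i = j then a - b else 0 := fun i j => by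
    split_ifs with h
    · subst h
      have := ha ![i] (Function.injective_of_subsingleton _)
      rw [add_sub_cancel, ← this]
      congr 1; funext l; fin_cases l <;> rfl
    · have := hb ![i, j] (by simpa [Function.Injective, Fin.forall_fin_two, eq_comm] using h)
      rw [add_zero, ← this]
      congr 1; funext l; fin_cases l <;> rfl
  refine ⟨a - b, fun f hf => ?_⟩
  rw [multilinear_eq_sum, sum_fin_two_arrow]
  simp only [key, Fin.prod_univ_two, Matrix.cons_val_zero, Matrix.cons_val_one, mul_add,
    Finset.sum_add_distrib, mul_ite, mul_zero, Finset.sum_ite_eq, Finset.mem_univ, if_true,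
    ← Finset.sum_mul, ← Finset.mul_sum, hf, zero_mul, zero_add]
  rw [mul_comm]

theorem trilinear_of_perm_invariant (M : MultilinearMap ℝ (fun _ : Fin 3 => J → ℝ) ℝ)
    (hM : ∀ (σ : Equiv.Perm J) (f : Fin 3 → J → ℝ), M (fun i => f i ∘ σ) = M f) :
    ∃ d, ∀ f : Fin 3 → J → ℝ, (∀ i, ∑ j, f i j = 0) → M f = d * ∑ j, ∏ i, f i j := by
  let T : (Fin 3 → J) → ℝ := fun x => M fun i => Pi.single (x i) 1
  have hT : ∀ (σ : Equiv.Perm J) x, T (σ ∘ x) = T x := perm_invariant_single M hM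
  obtain ⟨a, ha⟩ := exists_const_of_perm_invariant hT
    (![0, 0, 0] : Fin 3 → Fin 1)
  obtain ⟨b₁, hb₁⟩ := exists_const_of_perm_invariant hT
    (![0, 0, 1] : Fin 3 → Fin 2)
  obtain ⟨b₂, hb₂⟩ := exists_const_of_perm_invariant hT
    (![0, 1, 0] : Fin 3 → Fin 2)
  obtain ⟨b₃, hb₃⟩ := exists_const_of_perm_invariant hT
    (![1, 0, 0] : Fin 3 → Fin 2)
  obtain ⟨c, hc⟩ := exists_const_of_perm_invariant hT
    (![0, 1, 2] : Fin 3 → Fin 3)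
  have inj₂ : ∀ {i j : J}, i ≠ j → Function.Injective ![i, j] := fun h => by
    simpa [Function.Injective, Fin.forall_fin_two, eq_comm] using h
  -- Möbius inversion over the five partitions of three slots. Every term but the last leaves some
  -- index free, and summing over that index gives zero.
  have key : ∀ i j k : J, (M fun l => Pi.single (![i, j, k] l) 1) =
      c + (if i = j then b₁ - c else 0) + (if i = k then b₂ - c else 0) +
        (if j = k then b₃ - c else 0) +
        (if i = j then if i = k then a - b₁ - b₂ - b₃ + 2 * c else 0 else 0) := fun i j k => by
    by_cases hij : i = j
    · subst hij
      by_cases hik : i = k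
      · subst hik
        have := ha ![i] (Function.injective_of_subsingleton _)
        simp only [if_true]
        rw [show c + (b₁ - c) + (b₂ - c) + (b₃ - c) + (a - b₁ - b₂ - b₃ + 2 * c) = a by ring,
          ← this]
        congr 1; funext l; fin_cases l <;> rfl
      · have := hb₁ ![i, k] (inj₂ hik)
        simp only [hik, if_true, if_false, add_zero, add_sub_cancel]
        rw [← this]
        congr 1; funext l; fin_cases l <;> rfl
    · by_cases hik : i = k
      · subst hik
        have := hb₂ ![i, j] (inj₂ hij)
        simp only [hij, Ne.symm hij, if_true, if_false, add_zero, add_sub_cancel]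
        rw [← this]
        congr 1; funext l; fin_cases l <;> rfl
      · by_cases hjk : j = k
        · subst hjk
          have := hb₃ ![j, i] (inj₂ (Ne.symm hij))
          simp only [hij, if_true, if_false, add_zero, add_sub_cancel]
          rw [← this]
          congr 1; funext l; fin_cases l <;> rfl
        · have := hc ![i, j, k] (by
            simp [Function.Injective, Fin.forall_fin_succ, hij, hik, hjk, Ne.symm hij,
              Ne.symm hik, Ne.symm hjk])
          simp only [hij, hik, hjk, if_false, add_zero]
          rw [← this]
          congr 1; funext l; fin_cases l <;> rfl
  refine ⟨a - b₁ - b₂ - b₃ + 2 * c, fun f hf => ?_⟩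
  rw [multilinear_eq_sum, sum_fin_three_arrow]
  generalize a - b₁ - b₂ - b₃ + 2 * c = d at key ⊢
  have z₁ : ∀ (t : ℝ) i j, ∑ k, f 0 i * f 1 j * f 2 k * t = 0 := fun t i j => by
    rw [← Finset.sum_mul, ← Finset.mul_sum, hf, mul_zero, zero_mul]
  have z₂ : ∀ (t : ℝ) i, ∑ j, f 0 i * f 1 j * f 2 i * t = 0 := fun t i => by
    rw [← Finset.sum_mul, ← Finset.sum_mul, ← Finset.mul_sum, hf, mul_zero, zero_mul, zero_mul]
  have z₃ : ∀ t : ℝ, ∑ i, ∑ j, f 0 i * f 1 j * f 2 j * t = 0 := fun t => by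
    simp only [mul_assoc, ← Finset.mul_sum]
    rw [← Finset.sum_mul, hf, zero_mul]
  have z₄ : ∀ (t : ℝ) i j, ∑ k, (if i = j then f 0 i * f 1 j * f 2 k * t else 0) = 0 :=
    fun t i j => by split_ifs <;> simp [z₁]
  have z₅ : ∀ (t : ℝ) i j, ∑ k, (if i = j then if i = k then f 0 i * f 1 j * f 2 k * t else 0
      else 0) = if i = j then f 0 i * f 1 j * f 2 i * t else 0 := fun t i j => by
    split_ifs <;> simp
  have e : ∀ i j k, ∏ l, f l (![i, j, k] l) = f 0 i * f 1 j * f 2 k := fun i j k =>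
    Fin.prod_univ_three _
  simp only [key, e, mul_add, Finset.sum_add_distrib, mul_ite, mul_zero,
    z₁, z₄, z₅, Finset.sum_ite_eq, Finset.mem_univ, if_true, z₂, z₃,
    zero_add]
  rw [Finset.mul_sum]
  exact Finset.sum_congr rfl fun i _ => by rw [Fin.prod_univ_three]; ring

end PermInvariant

/-! ### Agreement with the canonical tensor on step vectors -/

section Agreement

variable {n : ℕ} [NeZero n]

/-- The `n`-tensor `Ψ` is `c` times the canonical one on the tangent vectors at `μ` that are given
by simple functions. -/
def AgreesOnStep {Ω : Type u} [MeasurableSpace Ω] (Ψ : TensorField n Ω n) (c : ℝ)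
    (μ : ProbabilityMeasure Ω) : Prop :=
  ∀ s : Fin n → SimpleFunc Ω ℝ, (Ψ.form μ fun i => stepTangent n μ (s i)) =
    c * canonicalForm n fun i => (stepTangent n μ (s i) : RootSpace n Ω)

variable {Θ : ∀ (Ω : Type u) [MeasurableSpace Ω], TensorField n Ω n}

theorem AgreesOnStep.map {Ω J : Type u} [MeasurableSpace Ω] [Finite J] [MeasurableSpace J]
    [MeasurableSingletonClass J] (hΘ : IsCongruentFamily Θ) {c : ℝ} {μ : ProbabilityMeasure Ω}
    (h : AgreesOnStep (Θ Ω) c μ) {κ : Ω → J} (hκ : Measurable κ) (hs : Function.Surjective κ) :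
    AgreesOnStep (Θ J) c (μ.map hκ.aemeasurable) := fun s => by
  rw [← form_comp_stepTangent hΘ μ hκ hs s, h, canonicalForm_comp_stepTangent]

theorem stepTangent_const {Ω : Type u} [MeasurableSpace Ω] (μ : ProbabilityMeasure Ω) (c : ℝ) :
    stepTangent n μ (SimpleFunc.const Ω c) = 0 := by
  apply Subtype.ext
  rw [coe_stepTangent']
  have : ∫ x, SimpleFunc.const Ω c x ∂(μ : Measure Ω) = c := by simp
  rw [this, sub_self, map_zero, map_zero, Submodule.coe_zero]

/-- This is how the continuity required of tensor fields enters: an identity along fixed vector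
fields passes to limits of base points. -/
theorem isClosed_agree {Ω : Type u} [MeasurableSpace Ω] (Ψ : TensorField n Ω n) (c : ℝ)
    (X : Fin n → VectorField n Ω) :
    IsClosed {μ : ProbRoot n Ω |
      (Ψ.form μ.measure fun j => ⟨(X j).toFun μ, (X j).mem_tangent μ⟩) =
        c * canonicalForm n fun j => (X j).toFun μ} :=
  isClosed_eq (Ψ.continuous_form X) (continuous_const.mul
    ((canonicalMultilinear Ω n).cont.comp (continuous_pi fun j => (X j).continuous_toFun)))

end Agreement

/-! ### Uniform distributions and the universal constant -/

section Uniform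

/-- The uniform distribution on a finite set. -/
def uniformProb (J : Type u) [Finite J] [Nonempty J] [MeasurableSpace J] :
    ProbabilityMeasure J :=
  ⟨(Nat.card J : ℝ≥0∞)⁻¹ • Measure.count, ⟨by
    have := Fintype.ofFinite J
    rw [Measure.smul_apply, Measure.count_univ, smul_eq_mul, ENat.card_eq_coe_natCard,
      ENat.toENNReal_coe]
    exact ENNReal.inv_mul_cancel (by exact_mod_cast Nat.card_pos.ne')
      (ENNReal.natCast_ne_top _)⟩⟩

variable {A : Type u} [Finite A] [Nonempty A] [MeasurableSpace A] [MeasurableSingletonClass A]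
  {J : Type u} [Finite J] [MeasurableSpace J] [MeasurableSingletonClass J]

theorem integral_uniformProb [Fintype A] (f : A → ℝ) :
    ∫ x, f x ∂(uniformProb A : Measure A) = (Nat.card A : ℝ)⁻¹ * ∑ x, f x := by
  change ∫ x, f x ∂((Nat.card A : ℝ≥0∞)⁻¹ • Measure.count) = _
  rw [integral_smul_measure, integral_fintype Integrable.of_finite]
  simp

theorem uniformProb_singleton (a : A) :
    (uniformProb A : Measure A) {a} = (Nat.card A : ℝ≥0∞)⁻¹ := by
  change (Nat.card A : ℝ≥0∞)⁻¹ * Measure.count {a} = _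
  rw [Measure.count_singleton, mul_one]

theorem map_uniformProb_singleton {J : Type u} [MeasurableSpace J] [MeasurableSingletonClass J]
    {κ : A → J} (hκ : Measurable κ) (j : J) :
    ((uniformProb A).map hκ.aemeasurable : Measure J) {j} =
      (Nat.card A : ℝ≥0∞)⁻¹ * (Nat.card (κ ⁻¹' {j}) : ℝ≥0∞) := by
  rw [ProbabilityMeasure.toMeasure_map, Measure.map_apply hκ (measurableSet_singleton j)]
  change (Nat.card A : ℝ≥0∞)⁻¹ * Measure.count (κ ⁻¹' {j}) = _
  rw [Measure.count_apply (Set.toFinite _).measurableSet, Nat.card_coe_set_eq,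
    ← Set.Finite.cast_ncard_eq (Set.toFinite _), ENat.toENNReal_coe]

theorem probabilityMeasure_ext_singleton {J : Type u} [Finite J] [MeasurableSpace J]
    {μ ν : ProbabilityMeasure J}
    (h : ∀ j, (μ : Measure J) {j} = (ν : Measure J) {j}) : μ = ν :=
  Subtype.ext (Measure.ext_of_singleton h)

theorem map_uniformProb [Nonempty J] {κ : A → J} (hκ : Measurable κ) {m : ℕ}
    (h : ∀ j, Nat.card (κ ⁻¹' {j}) = m) :
    (uniformProb A).map hκ.aemeasurable = uniformProb J := by
  have hA : Nat.card A = Nat.card J * m := by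
    have := Fintype.ofFinite J
    have h' : ∀ j, Nat.card {a // κ a = j} = m := h
    rw [Nat.card_congr (Equiv.sigmaFiberEquiv κ).symm, Nat.card_sigma]
    simp [h']
  have hA0 : Nat.card A ≠ 0 := Nat.card_pos.ne'
  have hm : (m : ℝ≥0∞) ≠ 0 := by
    rintro h0
    rw [Nat.cast_eq_zero.mp h0, mul_zero] at hA
    exact hA0 hA
  refine probabilityMeasure_ext_singleton fun j => ?_
  rw [map_uniformProb_singleton hκ, h]
  rw [uniformProb_singleton, hA, Nat.cast_mul,
    ENNReal.mul_inv (Or.inr (ENNReal.natCast_ne_top m)) (Or.inr hm),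
    mul_assoc, ENNReal.inv_mul_cancel hm (ENNReal.natCast_ne_top m), mul_one]

/-- Functions on a finite set, as simple functions. -/
def ofFiniteLinear (J : Type u) [Finite J] [MeasurableSpace J] [MeasurableSingletonClass J] :
    (J → ℝ) →ₗ[ℝ] SimpleFunc J ℝ where
  toFun := SimpleFunc.ofFinite
  map_add' _ _ := rfl
  map_smul' _ _ := rfl

variable {n : ℕ} [NeZero n] {Θ : ∀ (Ω : Type u) [MeasurableSpace Ω], TensorField n Ω n}

/-- A permutation is a statistic preserving the uniform distribution, so the form is permutation
invariant and `inv` applies. The constant may still depend on `J`. -/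
theorem exists_agreesOnStep_uniformProb
    (inv : ∀ (J : Type u) [Fintype J] [DecidableEq J]
      (M : MultilinearMap ℝ (fun _ : Fin n => J → ℝ) ℝ),
      (∀ (σ : Equiv.Perm J) (f : Fin n → J → ℝ), M (fun i => f i ∘ σ) = M f) →
      ∃ d, ∀ f : Fin n → J → ℝ, (∀ i, ∑ j, f i j = 0) → M f = d * ∑ j, ∏ i, f i j)
    (hΘ : IsCongruentFamily Θ) [Nonempty J] : ∃ c, AgreesOnStep (Θ J) c (uniformProb J) := by
  classical
  have := Fintype.ofFinite J
  let M : MultilinearMap ℝ (fun _ : Fin n => J → ℝ) ℝ :=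
    ((Θ J).form (uniformProb J)).compLinearMap fun _ => stepTangent n _ ∘ₗ ofFiniteLinear J
  have hM : ∀ (σ : Equiv.Perm J) (f : Fin n → J → ℝ), M (fun i => f i ∘ σ) = M f := fun σ f => by
    have hσ : Measurable σ := measurable_of_finite σ
    have h := form_comp_stepTangent hΘ (uniformProb J) hσ σ.surjective
      fun i => ofFiniteLinear J (f i)
    have e : (uniformProb J).map hσ.aemeasurable = uniformProb J :=
      map_uniformProb hσ (m := 1) fun j => by
        have : σ ⁻¹' {j} = {σ.symm j} := by ext x; simp [Equiv.eq_symm_apply]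
        rw [this, Nat.card_unique]
    rw [e] at h
    exact h
  obtain ⟨d, hd⟩ := inv J M hM
  have hn : ((n : ℝ) ^ n) ≠ 0 := pow_ne_zero _ (Nat.cast_ne_zero.mpr (NeZero.ne n))
  have hJ : (Nat.card J : ℝ) ≠ 0 := Nat.cast_ne_zero.mpr Nat.card_pos.ne'
  -- The factor compensates for `n^n` in the canonical tensor and for the mass `1 / |J|` of each
  -- point.
  refine ⟨d * Nat.card J / (n : ℝ) ^ n, fun s => ?_⟩
  let f : Fin n → J → ℝ := fun i x => s i x - ∫ y, s i y ∂(uniformProb J : Measure J)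
  have hf : ∀ i, ∑ j, f i j = 0 := fun i => by
    simp only [f, integral_uniformProb]
    rw [Finset.sum_sub_distrib, Finset.sum_const, Finset.card_univ, ← Nat.card_eq_fintype_card,
      nsmul_eq_mul, mul_inv_cancel_left₀ hJ, sub_self]
  -- Constants have zero step vector, so each `s i` may be replaced by its centred version.
  have e : ((Θ J).form (uniformProb J) fun i => stepTangent n _ (s i)) = M f := by
    change _ = (Θ J).form (uniformProb J) fun i => stepTangent n _ (ofFiniteLinear J (f i))
    congr 1
    funext i
    have : ofFiniteLinear J (f i) =
        s i - SimpleFunc.const J (∫ y, s i y ∂(uniformProb J : Measure J)) := rfl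
    rw [this, map_sub, stepTangent_const, sub_zero]
  rw [e, hd f hf, canonicalForm_stepTangent, integral_uniformProb]
  change _ = _ * (_ * (_ * ∑ x, ∏ i, f i x))
  field_simp

/-- Any `J` is compared with a three-point set `B` through `J × B`: both projections preserve
uniformity, so a constant for the product works for both factors, and over `B` it is unique. -/
theorem exists_agreesOnStep_uniformProb_forall
    (inv : ∀ (J : Type u) [Fintype J] [DecidableEq J]
      (M : MultilinearMap ℝ (fun _ : Fin n => J → ℝ) ℝ),
      (∀ (σ : Equiv.Perm J) (f : Fin n → J → ℝ), M (fun i => f i ∘ σ) = M f) →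
      ∃ d, ∀ f : Fin n → J → ℝ, (∀ i, ∑ j, f i j = 0) → M f = d * ∑ j, ∏ i, f i j)
    (hn : 2 + (-2 : ℝ) ^ n ≠ 0) (hΘ : IsCongruentFamily Θ) :
    ∃ c, ∀ (J : Type u) [Finite J] [Nonempty J] [MeasurableSpace J] [MeasurableSingletonClass J],
      AgreesOnStep (Θ J) c (uniformProb J) := by
  let B := ULift.{u} (Fin 3)
  obtain ⟨c, hc⟩ := exists_agreesOnStep_uniformProb (J := B) inv hΘ
  refine ⟨c, fun J _ _ _ _ => ?_⟩
  obtain ⟨c', hc'⟩ := exists_agreesOnStep_uniformProb (J := J × B) inv hΘ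
  have h1 : AgreesOnStep (Θ J) c' (uniformProb J) := by
    have h := hc'.map hΘ measurable_fst Prod.fst_surjective
    rwa [map_uniformProb measurable_fst (m := Nat.card B) fun j => by
      rw [← Set.prod_univ, Nat.card_coe_set_eq, Set.ncard_prod,
        Set.ncard_singleton, Set.ncard_univ, one_mul]] at h
  have h2 : AgreesOnStep (Θ B) c' (uniformProb B) := by
    have h := hc'.map hΘ measurable_snd Prod.snd_surjective
    rwa [map_uniformProb measurable_snd (m := Nat.card J) fun j => by
      rw [← Set.univ_prod, Nat.card_coe_set_eq, Set.ncard_prod,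
        Set.ncard_singleton, Set.ncard_univ, mul_one]] at h
  -- A mean zero function with `∑ f^n = 2 + (-2)^n ≠ 0`. Two points would not do for `n = 3`, as
  -- `(t, -t)` has vanishing cubic sum.
  let f : B → ℝ := fun b => ![1, 1, -2] b.down
  have hsum : ∀ g : B → ℝ, ∑ b, g b = g ⟨0⟩ + g ⟨1⟩ + g ⟨2⟩ := fun g => by
    rw [← Equiv.ulift.symm.sum_comp, Fin.sum_univ_three]; rfl
  let s : Fin n → SimpleFunc B ℝ := fun _ => ofFiniteLinear B f
  have hs : ∀ i, ∫ y, s i y ∂(uniformProb B : Measure B) = 0 := fun i => by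
    rw [integral_uniformProb, hsum]
    change _ * ((1 : ℝ) + 1 + -2) = 0
    norm_num
  have hne : canonicalForm n (fun i => (stepTangent n (uniformProb B) (s i) : RootSpace n B)) ≠
      0 := by
    rw [canonicalForm_stepTangent, integral_uniformProb]
    refine mul_ne_zero (pow_ne_zero _ (Nat.cast_ne_zero.mpr (NeZero.ne n)))
      (mul_ne_zero (inv_ne_zero (Nat.cast_ne_zero.mpr Nat.card_pos.ne')) ?_)
    simp only [hs, sub_zero]
    simp only [Finset.prod_const, Finset.card_univ, Fintype.card_fin, hsum, s]
    change (1 : ℝ) ^ n + 1 ^ n + (-2) ^ n ≠ 0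
    rw [one_pow, one_add_one_eq_two]
    exact hn
  have : c = c' := mul_right_cancel₀ hne ((hc s).symm.trans (h2 s))
  rwa [this]

end Uniform

/-! ### All probability measures on finite sets -/

section FiniteSets

variable {J : Type u} [Finite J] [MeasurableSpace J] [MeasurableSingletonClass J]
  {n : ℕ} [NeZero n]

variable (n) in
/-- The root `μ^{1/n}` of a probability measure as a point of `P^{1/n}(Ω)`. -/
def toProbRoot {Ω : Type u} [MeasurableSpace Ω] (μ : ProbabilityMeasure Ω) : ProbRoot n Ω := μ

variable (J n) in
/-- The map `f ↦ f m^{1/n}`, where `m` is the counting measure. -/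
def countMap : (J → ℝ) →ₗ[ℝ] RootSpace n J :=
  dominated n ⟨Measure.count, inferInstance⟩ ∘ₗ simpleLp n _ ∘ₗ ofFiniteLinear J

theorem root_eq_countMap (ν : ProbabilityMeasure J) :
    root n ν = countMap J n fun j => ((ν : Measure J).real {j}) ^ ((n : ℝ)⁻¹) := by
  have hn : (n : ℝ) ≠ 0 := Nat.cast_ne_zero.mpr (NeZero.ne n)
  refine root_eq_dominated ν ⟨Measure.count, inferInstance⟩ (measurable_of_finite _)
    (fun j => Real.rpow_nonneg measureReal_nonneg _) ?_
    ((SimpleFunc.ofFinite _).memLp_of_isFiniteMeasure n _)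
  refine Measure.ext_of_singleton fun j => ?_
  rw [withDensity_apply _ (measurableSet_singleton j), lintegral_singleton,
    Measure.count_singleton, mul_one, ← Real.rpow_natCast, ← Real.rpow_mul
    measureReal_nonneg, inv_mul_cancel₀ hn, Real.rpow_one, ofReal_measureReal]

/-- By `root_eq_countMap` all roots lie in the image of one linear map from the finite dimensional
space `J → ℝ`, which is continuous; convergence of the weights therefore suffices. -/
theorem tendsto_probRoot_of_tendsto_real {ι : Type*} {l : Filter ι}
    {ν : ι → ProbabilityMeasure J} {μ : ProbabilityMeasure J}
    (h : ∀ j, Filter.Tendsto (fun t => (ν t : Measure J).real {j}) l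
      (nhds ((μ : Measure J).real {j}))) :
    Filter.Tendsto (fun t => toProbRoot n (ν t)) l (nhds (toProbRoot n μ)) := by
  refine (Topology.IsInducing.mk rfl :
    Topology.IsInducing fun μ : ProbRoot n J => root n μ.measure).tendsto_nhds_iff.mpr ?_
  change Filter.Tendsto (fun t => root n (ν t)) l (nhds (root n μ))
  simp only [root_eq_countMap]
  refine ((countMap J n).continuous_of_finiteDimensional.tendsto _).comp
    (tendsto_pi_nhds.mpr fun j => ?_)
  exact (h j).rpow_const (Or.inr (by positivity))

theorem exists_weights_tendsto {J : Type*} [Fintype J] (p : J → ℝ) (h0 : ∀ j, 0 ≤ p j)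
    (h1 : ∑ j, p j = 1) :
    ∃ w : ℕ → J → ℕ, (∀ N j, 0 < w N j) ∧
      ∀ j, Filter.Tendsto (fun N => (w N j : ℝ) / ∑ i, (w N i : ℝ)) Filter.atTop
        (nhds (p j)) := by
  -- The added `1` keeps every weight positive, even where `p j = 0`, and disappears in the limit.
  refine ⟨fun N j => ⌊p j * N⌋₊ + 1, fun _ _ => Nat.succ_pos _, fun j => ?_⟩
  have h : ∀ j, Filter.Tendsto (fun N : ℕ => ((⌊p j * N⌋₊ + 1 : ℕ) : ℝ) / N) Filter.atTop
      (nhds (p j)) := fun j => by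
    have a := (tendsto_nat_floor_mul_div_atTop (h0 j)).comp tendsto_natCast_atTop_atTop
    have b := tendsto_one_div_atTop_nhds_zero_nat (𝕜 := ℝ)
    have := a.add b
    rw [add_zero] at this
    refine this.congr fun N => ?_
    simp [add_div]
  have hs : Filter.Tendsto (fun N : ℕ => ∑ j, ((⌊p j * N⌋₊ + 1 : ℕ) : ℝ) / N) Filter.atTop
      (nhds 1) := by
    rw [← h1]
    exact tendsto_finsetSum _ fun j _ => h j
  have hd := (h j).div hs one_ne_zero
  rw [div_one] at hd
  refine hd.congr' ?_
  filter_upwards [Filter.eventually_ne_atTop 0] with N hN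
  have hN' : (N : ℝ) ≠ 0 := Nat.cast_ne_zero.mpr hN
  simp only [Pi.div_apply]
  rw [← Finset.sum_div, div_div_div_cancel_right₀ hN']

variable {Θ : ∀ (Ω : Type u) [MeasurableSpace Ω], TensorField n Ω n} {c : ℝ}

theorem exists_agreesOnStep_weights (hΘ : IsCongruentFamily Θ)
    (hu : ∀ (J : Type u) [Finite J] [Nonempty J] [MeasurableSpace J] [MeasurableSingletonClass J],
      AgreesOnStep (Θ J) c (uniformProb J)) [Fintype J] [Nonempty J] (w : J → ℕ)
    (hw : ∀ j, 0 < w j) :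
    ∃ ν : ProbabilityMeasure J, (∀ j, (ν : Measure J).real {j} = w j / ∑ i, (w i : ℝ)) ∧
      AgreesOnStep (Θ J) c ν := by
  -- Each `j` is split into `w j` equally likely points; positivity of the weights makes the
  -- projection surjective.
  let A := Σ j, Fin (w j)
  let _ : MeasurableSpace A := ⊤
  have : MeasurableSingletonClass A := ⟨fun _ => trivial⟩
  have : Nonempty A := ⟨⟨Classical.arbitrary J, ⟨0, hw _⟩⟩⟩
  have hκ : Measurable (Sigma.fst : A → J) := measurable_from_top
  refine ⟨(uniformProb A).map hκ.aemeasurable, fun j => ?_,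
    (hu A).map hΘ hκ fun j => ⟨⟨j, ⟨0, hw j⟩⟩, rfl⟩⟩
  have e : Nat.card ((Sigma.fst : A → J) ⁻¹' {j}) = w j := by
    rw [← Set.range_sigmaMk, Nat.card_range_of_injective sigma_mk_injective, Nat.card_fin]
  have e2 : Nat.card A = ∑ i, w i := by simp [A]
  rw [measureReal_def, map_uniformProb_singleton hκ, e, e2, ENNReal.toReal_mul, ENNReal.toReal_inv,
    ENNReal.toReal_natCast, ENNReal.toReal_natCast, Nat.cast_sum, div_eq_inv_mul]

theorem agreesOnStep_of_finite (hΘ : IsCongruentFamily Θ)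
    (hu : ∀ (J : Type u) [Finite J] [Nonempty J] [MeasurableSpace J] [MeasurableSingletonClass J],
      AgreesOnStep (Θ J) c (uniformProb J)) (μ : ProbabilityMeasure J) :
    AgreesOnStep (Θ J) c μ := fun s => by
  have := Fintype.ofFinite J
  have : Nonempty J := nonempty_of_isProbabilityMeasure (μ : Measure J)
  obtain ⟨w, hw, hlim⟩ := exists_weights_tendsto (fun j => (μ : Measure J).real {j})
    (fun j => measureReal_nonneg) (by rw [sum_measureReal_singleton]; simp)
  choose ν hν hν' using fun N => exists_agreesOnStep_weights hΘ hu (w N) (hw N)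
  have ht : Filter.Tendsto (fun N => toProbRoot n (ν N)) Filter.atTop (nhds (toProbRoot n μ)) :=
    tendsto_probRoot_of_tendsto_real fun j => by simpa only [hν] using hlim j
  exact (isClosed_agree (Θ J) c fun i => stepField n (s i)).mem_of_tendsto ht
    (Filter.Eventually.of_forall fun N => hν' N s)

end FiniteSets

/-! ### Step vectors over arbitrary spaces -/

section Steps

variable {n : ℕ} [NeZero n] {Θ : ∀ (Ω : Type u) [MeasurableSpace Ω], TensorField n Ω n} {c : ℝ}

/-- Finitely many simple functions factor through one finite statistic. -/
theorem exists_finite_factor {n : ℕ} {Ω : Type u} [MeasurableSpace Ω] (s : Fin n → SimpleFunc Ω ℝ) :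
    ∃ (J : Type u) (_ : Finite J) (_ : MeasurableSpace J) (_ : MeasurableSingletonClass J)
      (κ : Ω → J) (hκ : Measurable κ) (t : Fin n → SimpleFunc J ℝ),
      Function.Surjective κ ∧ ∀ i, s i = (t i).comp κ hκ := by
  let F : Ω → Fin n → ℝ := fun x i => s i x
  -- The quotient of `Ω` is used instead of the range of `F`, because it lies in the universe of
  -- `Ω`, where `Θ` is defined.
  let J := Quotient (Setoid.ker F)
  let _ : MeasurableSpace J := ⊤
  have hF : (Set.range F).Finite := (Set.Finite.pi' fun i => (s i).finite_range).subset (by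
    rintro _ ⟨x, rfl⟩ i
    exact ⟨x, rfl⟩)
  have := hF.to_subtype
  have : Finite J := Finite.of_equiv _ (Setoid.quotientKerEquivRange F).symm
  have : MeasurableSingletonClass J := ⟨fun _ => trivial⟩
  have hκ : Measurable (Quotient.mk (Setoid.ker F)) := by
    refine measurable_to_countable fun x => ?_
    have : Quotient.mk (Setoid.ker F) ⁻¹' {Quotient.mk (Setoid.ker F) x} =
        ⋂ i, s i ⁻¹' {s i x} := by
      ext y
      simp only [Set.mem_preimage, Set.mem_singleton_iff, Set.mem_iInter, Quotient.eq]
      exact funext_iff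
    rw [this]
    exact MeasurableSet.iInter fun i => (s i).measurableSet_fiber _
  exact ⟨J, inferInstance, inferInstance, inferInstance, Quotient.mk _, hκ,
    fun i => SimpleFunc.ofFinite (Quotient.lift (s i) fun a b h => congrFun h i),
    Quotient.mk_surjective, fun i => SimpleFunc.ext fun x => rfl⟩

theorem agreesOnStep (hΘ : IsCongruentFamily Θ)
    (hu : ∀ (J : Type u) [Finite J] [Nonempty J] [MeasurableSpace J] [MeasurableSingletonClass J],
      AgreesOnStep (Θ J) c (uniformProb J)) {Ω : Type u} [MeasurableSpace Ω]
    (μ : ProbabilityMeasure Ω) : AgreesOnStep (Θ Ω) c μ := fun s => by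
  obtain ⟨J, _, _, _, κ, hκ, t, hs, e⟩ := exists_finite_factor s
  simp only [e]
  rw [form_comp_stepTangent hΘ μ hκ hs t, canonicalForm_comp_stepTangent,
    agreesOnStep_of_finite hΘ hu]

end Steps

/-! ### Vector fields through a given vector, step vectors elsewhere -/

section Interpolation

/-- The Weierstrass M-test, for a limit that is given pointwise. -/
theorem continuous_of_tendsto_sum {X E : Type*} [TopologicalSpace X] [NormedAddCommGroup E]
    {f : ℕ → X → E} {F : X → E} {b : ℕ → ℝ} (hf : ∀ i, Continuous (f i)) (hb : Summable b)
    (hfb : ∀ i x, ‖f i x‖ ≤ b i)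
    (hF : ∀ x, Filter.Tendsto (fun N => ∑ i ∈ Finset.range N, f i x) Filter.atTop (nhds (F x))) :
    Continuous F := by
  have hu : TendstoUniformly (fun N x => ∑ i ∈ Finset.range N, f i x) F Filter.atTop := by
    rw [Metric.tendstoUniformly_iff]
    intro ε hε
    filter_upwards [(tendsto_sum_nat_add b).eventually_lt_const hε] with N hN x
    rw [dist_comm]
    refine lt_of_le_of_lt (dist_le_tsum_of_dist_le_of_tendsto b (fun i => ?_) hb (hF x) N) ?_
    · rw [Finset.sum_range_succ, dist_self_add_right]
      exact hfb i x
    · simpa only [add_comm N] using hN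
  exact hu.continuous (Filter.Frequently.of_forall fun N =>
    continuous_finsetSum _ fun i _ => hf i)

variable {Ω : Type u} [MeasurableSpace Ω] {n : ℕ} [NeZero n]

theorem exists_radius (μ : ProbRoot n Ω) {F : ProbRoot n Ω → RootSpace n Ω} (hF : Continuous F)
    {ε : ℝ} (hε : 0 < ε) : ∃ r > 0, ∀ ν : ProbRoot n Ω,
      ‖root n ν.measure - root n μ.measure‖ < r → ‖F ν - F μ‖ < ε := by
  have h := hF.tendsto μ
  rw [(Topology.IsInducing.mk rfl :
    Topology.IsInducing fun μ : ProbRoot n Ω => root n μ.measure).nhds_eq_comap μ,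
    (Metric.nhds_basis_ball.comap _).tendsto_iff Metric.nhds_basis_ball] at h
  obtain ⟨r, hr, h⟩ := h ε hε
  refine ⟨r, hr, fun ν hν => ?_⟩
  rw [← dist_eq_norm]
  exact h ν (by simpa [dist_eq_norm] using hν)

/-- Through every tangent vector at `μ` there is a vector field which at all other points is given
by simple functions. -/
theorem exists_vectorField (μ : ProbRoot n Ω) (V : tangent n μ.measure) :
    ∃ X : VectorField n Ω, X.toFun μ = V ∧
      ∀ ν ≠ μ, ∃ s, X.toFun ν = stepTangent n ν.measure s := by
  let H : AddSubgroup (RootSpace n Ω) :=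
    (LinearMap.range ((tangent n μ.measure).subtype ∘ₗ stepTangent n μ.measure)).toAddSubgroup
  have hV : (V : RootSpace n Ω) ∈ closure (H : Set (RootSpace n Ω)) := by
    have h := mem_closure_range_stepTangent μ.measure V
    convert h using 2
    exact LinearMap.coe_range _
  -- `V` is the sum of step vectors `v i` at `μ` with `‖v i‖ < 2^{-i}` for `i > 0`. Each is extended
  -- by its step field, cut off near `μ`.
  obtain ⟨v, hv, hvH, -, hvb⟩ := controlled_sum_of_mem_closure hV
    (b := fun i => (1 / 2 : ℝ) ^ i) fun i => by positivity
  choose s hs using hvH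
  have hs' : ∀ i, (stepTangent n μ.measure (s i) : RootSpace n Ω) = v i := hs
  choose r' hr' hr'b using fun i => exists_radius μ (continuous_stepTangent (n := n) (s i))
    (show (0 : ℝ) < (1 / 2) ^ i by positivity)
  -- The radius `r' i` keeps the `i`-th step field within `2^{-i}` of `v i`, so the cut-off series
  -- converges uniformly; the bound `1 / (i + 1)` leaves only finitely many nonzero terms at each
  -- point other than `μ`.
  let r : ℕ → ℝ := fun i => min (r' i) (1 / (i + 1))
  have hr : ∀ i, 0 < r i := fun i => lt_min (hr' i) Nat.one_div_pos_of_nat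
  let d : ProbRoot n Ω → ℝ := fun ν => ‖root n ν.measure - root n μ.measure‖
  have hd : Continuous d := (continuous_root.sub continuous_const).norm
  let h : ℕ → ProbRoot n Ω → ℝ := fun i ν => max 0 (1 - d ν / r i)
  have hhc : ∀ i, Continuous (h i) := fun i =>
    continuous_const.max (continuous_const.sub (hd.div_const _))
  have hh0 : ∀ i ν, 0 ≤ h i ν := fun i ν => le_max_left _ _
  have hh1 : ∀ i ν, h i ν ≤ 1 := fun i ν => max_le zero_le_one
    (sub_le_self _ (div_nonneg (norm_nonneg _) (hr i).le))
  have hhμ : ∀ i, h i μ = 1 := fun i => by simp [h, d]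
  have hhr : ∀ i ν, r i ≤ d ν → h i ν = 0 := fun i ν hν =>
    max_eq_left (sub_nonpos.mpr ((one_le_div (hr i)).mpr hν))
  let f : ℕ → ProbRoot n Ω → RootSpace n Ω := fun i ν => h i ν • (stepTangent n ν.measure (s i) :
    RootSpace n Ω)
  have hfc : ∀ i, Continuous (f i) := fun i => (hhc i).smul (continuous_stepTangent (s i))
  have hfb : ∀ i ν, ‖f i ν‖ ≤ ‖v i‖ + (1 / 2) ^ i := fun i ν => by
    by_cases hν : r i ≤ d ν
    · simp only [f, hhr i ν hν, zero_smul, norm_zero]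
      positivity
    · have h1 := hr'b i ν (lt_of_lt_of_le (not_le.mp hν) (min_le_left _ _))
      rw [hs' i] at h1
      calc ‖f i ν‖ = h i ν * ‖(stepTangent n ν.measure (s i) : RootSpace n Ω)‖ := by
            rw [norm_smul, Real.norm_of_nonneg (hh0 i ν)]
        _ ≤ ‖(stepTangent n ν.measure (s i) : RootSpace n Ω)‖ :=
            mul_le_of_le_one_left (norm_nonneg _) (hh1 i ν)
        _ ≤ ‖v i‖ + (1 / 2) ^ i := by
            have := norm_le_norm_add_norm_sub (v i)
              (stepTangent n ν.measure (s i) : RootSpace n Ω)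
            rw [norm_sub_rev] at this
            linarith
  have hgeo : Summable fun i : ℕ => (1 / 2 : ℝ) ^ i := summable_geometric_two
  have hsum : Summable fun i => ‖v i‖ + (1 / 2 : ℝ) ^ i := by
    -- The shift drops `v 0`, which is close to `V` and need not be small.
    refine Summable.add ((summable_nat_add_iff 1).mp ?_) hgeo
    exact Summable.of_nonneg_of_le (fun i => norm_nonneg _)
      (fun i => (hvb (i + 1) (Nat.succ_pos i)).le) ((summable_nat_add_iff 1).mpr hgeo)
  have hex : ∀ ν, ∃ x, Filter.Tendsto (fun N => ∑ i ∈ Finset.range N, f i ν) Filter.atTop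
      (nhds x) ∧ (ν = μ → x = V) ∧ (ν ≠ μ → ∃ t, x = stepTangent n ν.measure t) := fun ν => by
    by_cases hν : ν = μ
    · subst hν
      refine ⟨V, ?_, fun _ => rfl, fun h => (h rfl).elim⟩
      rw [← Filter.tendsto_add_atTop_iff_nat 1]
      refine hv.congr fun N => Finset.sum_congr rfl fun i _ => ?_
      simp only [f, hhμ, one_smul, hs']
    · have hdν : 0 < d ν := norm_pos_iff.mpr (sub_ne_zero.mpr fun e => hν (root_injective n e))
      obtain ⟨N₀, hN₀⟩ := exists_nat_one_div_lt hdν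
      refine ⟨_, tendsto_atTop_of_eventually_const (i₀ := N₀)
        (x := ∑ i ∈ Finset.range N₀, f i ν) fun N hN => ?_, fun h => (hν h).elim, fun _ =>
        ⟨∑ i ∈ Finset.range N₀, h i ν • s i, ?_⟩⟩
      · refine (Finset.sum_subset (Finset.range_mono hN) fun i _ hi => ?_).symm
        have hi' : N₀ ≤ i := by simpa using hi
        have : r i ≤ d ν := (min_le_right _ _).trans
          ((Nat.one_div_le_one_div hi').trans hN₀.le)
        simp only [f, hhr i ν this, zero_smul]
      · simp [f, map_sum]
  choose X hX hXμ hXν using hex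
  refine ⟨⟨X, continuous_of_tendsto_sum hfc hsum hfb hX, fun ν => ?_⟩, hXμ μ rfl, hXν⟩
  by_cases hν : ν = μ
  · subst hν
    rw [hXμ ν rfl]
    exact V.2
  · obtain ⟨t, ht⟩ := hXν ν hν
    rw [ht]
    exact Subtype.prop _

end Interpolation

/-! ### Limits at non-isolated points -/

section NotIsolated

variable {Ω : Type u} [MeasurableSpace Ω] {n : ℕ} [NeZero n]

theorem abs_sub_one_le_abs_pow_sub_one {x : ℝ} (hx : 0 ≤ x) {n : ℕ} (hn : n ≠ 0) :
    |x - 1| ≤ |x ^ n - 1| := by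
  rcases le_total 1 x with h | h
  · have := le_self_pow₀ h hn
    rw [abs_of_nonneg (by linarith), abs_of_nonneg (by linarith)]
    linarith
  · have := pow_le_of_le_one hx h hn
    rw [abs_of_nonpos (by linarith), abs_of_nonpos (by linarith)]
    linarith

/-- A probability measure with `0 < μ(A) < 1` is approximated by tilting it towards `A`. -/
theorem mem_closure_compl_singleton_of_measure (μ : ProbabilityMeasure Ω) {A : Set Ω}
    (hA : MeasurableSet A) (h0 : (μ : Measure Ω).real A ≠ 0) (h1 : (μ : Measure Ω).real A ≠ 1) :
    toProbRoot n μ ∈ closure {toProbRoot n μ}ᶜ := by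
  set a := (μ : Measure Ω).real A with ha
  have ha1 : a ≤ 1 := measureReal_le_one
  have ha0 : 0 ≤ a := measureReal_nonneg
  -- The density `1 + t y` is nonnegative for `0 < t ≤ 1`, since `|y| ≤ 1`, and has total mass one,
  -- since `y` has mean zero. It changes the mass of `A` by `t (1 - a) a ≠ 0`.
  let y : Ω → ℝ := fun x => A.indicator 1 x - a
  have hy : Measurable y := (measurable_one.indicator hA).sub_const a
  have hy1 : ∀ x, |y x| ≤ 1 := fun x => by
    by_cases hx : x ∈ A <;> simp only [y, hx, Set.indicator_of_mem, Set.indicator_of_notMem,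
      not_false_eq_true, Pi.one_apply, abs_le] <;> constructor <;> linarith
  have hyi : Integrable y (μ : Measure Ω) :=
    Integrable.of_bound hy.aestronglyMeasurable 1 (Filter.Eventually.of_forall hy1)
  have hyint : ∫ x, y x ∂(μ : Measure Ω) = 0 := by
    change ∫ x, (A.indicator (fun _ => (1 : ℝ)) x - a) ∂(μ : Measure Ω) = 0
    rw [integral_sub ((integrable_const (1 : ℝ)).indicator hA) (integrable_const _),
      integral_indicator hA]
    simp [ha]
  let t : ℕ → ℝ := fun N => 1 / (N + 2)
  have ht0 : ∀ N, 0 < t N := fun N => by positivity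
  have ht1 : ∀ N, t N ≤ 1 := fun N => by
    rw [div_le_one (by positivity)]
    have : (0 : ℝ) ≤ N := Nat.cast_nonneg N
    linarith
  have hpos : ∀ N x, 0 ≤ 1 + t N * y x := fun N x => by
    have h := (abs_mul (t N) (y x)).le.trans
      (mul_le_mul ((abs_of_pos (ht0 N)).le.trans (ht1 N)) (hy1 x) (abs_nonneg _) zero_le_one)
    have := neg_abs_le (t N * y x)
    linarith
  have hti : ∀ N, Integrable (fun x => 1 + t N * y x) (μ : Measure Ω) := fun N =>
    (integrable_const _).add (hyi.const_mul _)
  let ν : ℕ → ProbabilityMeasure Ω := fun N =>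
    ⟨(μ : Measure Ω).withDensity fun x => ENNReal.ofReal (1 + t N * y x), ⟨by
      rw [withDensity_apply _ MeasurableSet.univ, Measure.restrict_univ,
        ← ofReal_integral_eq_lintegral_ofReal (hti N) (Filter.Eventually.of_forall (hpos N)),
        integral_add (integrable_const _) (hyi.const_mul _), integral_const_mul, hyint]
      simp⟩⟩
  have hne : ∀ N, ν N ≠ μ := fun N e => by
    have h : (ν N : Measure Ω) A = (μ : Measure Ω) A := by rw [e]
    change ((μ : Measure Ω).withDensity fun x => ENNReal.ofReal (1 + t N * y x)) A = _ at h
    rw [withDensity_apply _ hA, setLIntegral_congr_fun (g := fun _ =>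
      ENNReal.ofReal (1 + t N * (1 - a))) hA fun x hx => by simp [y, hx],
      setLIntegral_const] at h
    have h' := congrArg ENNReal.toReal h
    rw [ENNReal.toReal_mul, ENNReal.toReal_ofReal
      (add_nonneg zero_le_one (mul_nonneg (ht0 N).le (sub_nonneg.mpr ha1)))] at h'
    change (1 + t N * (1 - a)) * a = a at h'
    have : t N * (1 - a) * a = 0 := by linarith
    have := mul_ne_zero (mul_ne_zero (ht0 N).ne' (sub_ne_zero.mpr h1.symm)) h0
    contradiction
  have hn : (n : ℝ) ≠ 0 := Nat.cast_ne_zero.mpr (NeZero.ne n)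
  let g : ℕ → Ω → ℝ := fun N x => (1 + t N * y x) ^ ((n : ℝ)⁻¹)
  have hg0 : ∀ N x, 0 ≤ g N x := fun N x => Real.rpow_nonneg (hpos N x) _
  have hgn : ∀ N x, g N x ^ n = 1 + t N * y x := fun N x => by
    rw [← Real.rpow_natCast, ← Real.rpow_mul (hpos N x), inv_mul_cancel₀ hn, Real.rpow_one]
  have hgm : ∀ N, Measurable (g N) := fun N => ((hy.const_mul _).const_add _).pow_const _
  -- Taking a root does not increase the distance from `1`, so the roots of the tilted measures
  -- converge uniformly in the density.
  have hgt : ∀ N x, |g N x - 1| ≤ t N := fun N x => by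
    refine (abs_sub_one_le_abs_pow_sub_one (hg0 N x) (NeZero.ne n)).trans ?_
    rw [hgn, add_sub_cancel_left, abs_mul, abs_of_pos (ht0 N)]
    exact mul_le_of_le_one_right (ht0 N).le (hy1 x)
  have hgL : ∀ N, MemLp (g N) n (toFin μ).val := fun N =>
    MemLp.of_bound (hgm N).aestronglyMeasurable 2 (Filter.Eventually.of_forall fun x => by
      have := abs_le.mp (hgt N x)
      have := ht1 N
      rw [Real.norm_of_nonneg (hg0 N x)]
      linarith)
  have hroot : ∀ N, ‖root n (ν N) - root n μ‖ ≤ t N := fun N => by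
    rw [root_eq_dominated (ν N) (toFin μ) (hgm N) (hg0 N) (by simp only [hgn]; rfl) (hgL N), root,
      ← map_sub, norm_dominated]
    refine (Lp.norm_le_of_ae_bound (C := t N) (ht0 N).le ?_).trans ?_
    · filter_upwards [Lp.coeFn_sub ((hgL N).toLp _) ((memLp_const (1 : ℝ)).toLp _),
        (hgL N).coeFn_toLp, root_coeFn (n := n) μ] with x h1 h2 h3
      rw [h1, Pi.sub_apply, h2, h3]
      exact hgt N x
    · simp [measureUnivNNReal]
  refine mem_closure_of_tendsto (f := fun N => toProbRoot n (ν N)) (b := Filter.atTop) ?_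
    (Filter.Eventually.of_forall hne)
  refine (Topology.IsInducing.mk rfl :
    Topology.IsInducing fun μ : ProbRoot n Ω => root n μ.measure).tendsto_nhds_iff.mpr ?_
  refine tendsto_iff_norm_sub_tendsto_zero.mpr (squeeze_zero (fun _ => norm_nonneg _) hroot ?_)
  have := (Filter.tendsto_add_atTop_iff_nat (f := fun N : ℕ => 1 / (N : ℝ)) 2).mpr
    tendsto_one_div_atTop_nhds_zero_nat
  simpa [t] using this

/-- A function of mean zero that is not almost everywhere zero is positive on a set of measure
strictly between `0` and `1`. -/
theorem mem_closure_compl_singleton (μ : ProbabilityMeasure Ω) {V : tangent n μ} (hV : V ≠ 0) :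
    toProbRoot n μ ∈ closure {toProbRoot n μ}ᶜ := by
  obtain ⟨_, φ, hφ, rfl⟩ := V
  have hφ0 : ∫ x, φ x ∂(toFin μ).val = 0 := hφ
  have hφi : Integrable φ (toFin μ).val := integrable_coe φ
  have hne : ¬ (φ =ᵐ[(toFin μ).val] 0) := fun h => hV (by
    have : φ = 0 := (Lp.eq_zero_iff_ae_eq_zero).mpr h
    exact Subtype.ext ((congrArg _ this).trans (map_zero _)))
  have hA : MeasurableSet {x | 0 < φ x} :=
    measurableSet_lt measurable_const (Lp.stronglyMeasurable φ).measurable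
  refine mem_closure_compl_singleton_of_measure μ hA (fun h => hne ?_) fun h => hne ?_
  · have h' : (toFin μ).val {x | 0 < φ x} = 0 := (measureReal_eq_zero_iff).mp h
    have hle : ∀ᵐ x ∂(toFin μ).val, 0 ≤ (-φ : Ω → ℝ) x := by
      filter_upwards [measure_eq_zero_iff_ae_notMem.mp h'] with x hx
      simpa using hx
    have := (integral_eq_zero_iff_of_nonneg_ae hle hφi.neg).mp (by
      simp only [Pi.neg_apply, integral_neg, hφ0, neg_zero])
    filter_upwards [this] with x hx
    simpa using hx
  · have h' : ∀ᵐ x ∂(toFin μ).val, x ∈ {x | 0 < φ x} := by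
      refine mem_ae_iff.mpr ?_
      exact (measureReal_eq_zero_iff).mp ((probReal_compl_eq_one_sub hA).trans
        (sub_eq_zero.mpr h.symm))
    exact (integral_eq_zero_iff_of_nonneg_ae (h'.mono fun x hx => le_of_lt hx) hφi).mp hφ0

/-- If `V 0 = 0`, both sides vanish. Otherwise `μ` is a limit of other points, where the
interpolating fields are step vectors and the identity is known. -/
theorem form_eq_canonicalForm {Ψ : TensorField n Ω n} {c : ℝ}
    (h : ∀ ν : ProbabilityMeasure Ω, AgreesOnStep Ψ c ν) (μ : ProbabilityMeasure Ω)
    (V : Fin n → tangent n μ) :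
    Ψ.form μ V = c * canonicalForm n fun i => (V i : RootSpace n Ω) := by
  by_cases hV : V 0 = 0
  · rw [(Ψ.form μ).map_coord_zero 0 hV, ← canonicalMultilinear_apply,
      (canonicalMultilinear Ω n).map_coord_zero 0 (by rw [hV]; rfl), mul_zero]
  choose X hX hXν using fun i => exists_vectorField (toProbRoot n μ) (V i)
  have hc := (isClosed_agree Ψ c X).closure_subset_iff.mpr
    (fun ν hν => ?_) (mem_closure_compl_singleton μ hV)
  · have e : (fun j => (⟨(X j).toFun (toProbRoot n μ), (X j).mem_tangent _⟩ : tangent n μ)) = V :=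
      funext fun j => Subtype.ext (hX j)
    have e' : (fun j => (X j).toFun (toProbRoot n μ)) = fun j => (V j : RootSpace n Ω) := funext hX
    rw [← e', ← e]
    exact hc
  · choose s hs using fun i => hXν i ν hν
    have e : (fun j => (⟨(X j).toFun ν, (X j).mem_tangent _⟩ : tangent n ν.measure)) =
      fun j => stepTangent n ν.measure (s j) := funext fun j => Subtype.ext (hs j)
    change Ψ.form ν.measure _ = _
    rw [e]
    simp only [hs]
    exact h ν.measure s

end NotIsolated

/-! ### Differentials of models are tangent -/

section ModelTangency

variable {Ω : Type u} [MeasurableSpace Ω] {n : ℕ} [NeZero n]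
  {E : Type*} [NormedAddCommGroup E] [NormedSpace ℝ E] {H : Type*} [TopologicalSpace H]
  {I : ModelWithCorners ℝ E H} {M : Type*} [TopologicalSpace M] [ChartedSpace H M]
  [BoundarylessManifold I M]

/-- A function that is minimal at `p(ξ)^{1/n}` along a model has vanishing derivative along the
differential of the model. -/
theorem fderiv_rootDeriv_eq_zero {p : M → ProbabilityMeasure Ω} {ξ : M}
    (hp : MDifferentiableAt I 𝓘(ℝ, RootSpace n Ω) (fun η => root n (p η)) ξ)
    {Φ : RootSpace n Ω → ℝ} {Φ' : RootSpace n Ω →L[ℝ] ℝ} (hΦ : HasFDerivAt Φ Φ' (root n (p ξ)))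
    (hmin : ∀ η, Φ (root n (p ξ)) ≤ Φ (root n (p η))) (v : TangentSpace I ξ) :
    Φ' (rootDeriv I n p ξ v) = 0 := by
  let G : E → RootSpace n Ω := fun e => root n (p ((extChartAt I ξ).symm e))
  let F' : E →L[ℝ] RootSpace n Ω := mfderiv I 𝓘(ℝ, RootSpace n Ω) (fun η => root n (p η)) ξ
  -- Without boundary, `range I` is a neighbourhood of the chart point, so the derivative within it
  -- is a full derivative and Fermat's criterion applies.
  have hG : HasFDerivAt G F' (extChartAt I ξ ξ) := by
    have h : HasFDerivWithinAt G F' (Set.range I) (extChartAt I ξ ξ) := hp.hasMFDerivAt.2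
    exact h.hasFDerivAt (mem_interior_iff_mem_nhds.mp
      (BoundarylessManifold.isInteriorPoint (I := I) (x := ξ)))
  have hG0 : G (extChartAt I ξ ξ) = root n (p ξ) := by
    simp only [G, extChartAt_to_inv]
  rw [← hG0] at hΦ
  -- Even outside the chart `G` takes values in roots of the model, so the minimum is global.
  have hloc : IsLocalMin (Φ ∘ G) (extChartAt I ξ ξ) := Filter.Eventually.of_forall fun e => by
    rw [Function.comp_apply, hG0]
    exact hmin _
  exact DFunLike.congr_fun (hloc.hasFDerivAt_eq_zero (hΦ.comp _ hG)) v

theorem canonicalForm_update_nonneg {ρ : FinMeasure Ω} {ψ : Lp ℝ n ρ.val}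
    (hψ : 0 ≤ᵐ[ρ.val] ψ) (ν : ProbabilityMeasure Ω) :
    0 ≤ canonicalForm n (Function.update (fun _ => dominated n ρ ψ) 0 (root n ν)) := by
  obtain ⟨τ, hρ, hν⟩ := exists_ge_ge ρ (toFin ν)
  have key : ∀ {σ : FinMeasure Ω} (hσ : σ ≤ τ) {χ : Lp ℝ n σ.val}, 0 ≤ᵐ[σ.val] χ →
      0 ≤ᵐ[τ.val] trans n _ _ hσ χ := fun {σ} hσ χ hχ => by
    have e : (χ : Ω → ℝ) =ᵐ[σ.val] fun x => |χ x| := by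
      filter_upwards [hχ] with x hx
      exact (abs_of_nonneg hx).symm
    filter_upwards [coeFn_trans n hσ χ, transFun_congr n hσ e] with x h1 h2
    rw [h1, h2, transFun]
    exact mul_nonneg (abs_nonneg _) (Real.rpow_nonneg ENNReal.toReal_nonneg _)
  have h1 : 0 ≤ᵐ[(toFin ν).val] ((memLp_const (1 : ℝ)).toLp _ : Lp ℝ n (toFin ν).val) := by
    filter_upwards [root_coeFn (n := n) ν] with x hx
    rw [hx]
    exact zero_le_one
  rw [root, ← dominated_trans hν, ← dominated_trans hρ, update_dominated
    (fun _ => trans n _ _ hρ ψ), canonicalForm_dominated]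
  refine mul_nonneg (by positivity) (integral_nonneg_of_ae ?_)
  filter_upwards [key hρ hψ, key hν h1] with x hx hx'
  rw [prod_update_apply]
  exact mul_nonneg hx' (Finset.prod_nonneg fun _ _ => hx)

/-- For `n ≥ 2` at least one slot holds the indicator, and its powers are again the indicator of
`B`. -/
theorem canonicalForm_update_indicator (hn : 2 ≤ n) (ρ : FinMeasure Ω) (w : Lp ℝ n ρ.val)
    {B : Set Ω} (hB : MeasurableSet B) {χ : Lp ℝ n ρ.val}
    (hχ : χ =ᵐ[ρ.val] B.indicator fun _ => (1 : ℝ)) :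
    canonicalForm n (Function.update (fun _ => dominated n ρ χ) 0 (dominated n ρ w)) =
      (n : ℝ) ^ n * ∫ x in B, w x ∂ρ.val := by
  rw [update_dominated (fun _ => χ), canonicalForm_dominated, ← integral_indicator hB]
  congr 1
  apply integral_congr_ae
  filter_upwards [hχ] with x hx
  rw [prod_update_apply, Finset.prod_const, hx, Finset.card_sdiff, Finset.card_univ,
    Fintype.card_fin, Finset.inter_univ, Finset.card_singleton]
  by_cases h : x ∈ B
  · simp [h]
  · have : n - 1 ≠ 0 := by omega
    simp [h, this]

theorem rootDeriv_mem_tangent (hn : 2 ≤ n) {p : M → ProbabilityMeasure Ω} {ξ : M}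
    (hp : MDifferentiableAt I 𝓘(ℝ, RootSpace n Ω) (fun η => root n (p η)) ξ)
    (v : TangentSpace I ξ) : rootDeriv I n p ξ v ∈ tangent n (p ξ) := by
  set W := rootDeriv I n p ξ v with hW
  obtain ⟨ρ', w', hw'⟩ := exists_dominated W
  obtain ⟨ρ, hρ', hρ⟩ := exists_ge_ge ρ' (toFin (p ξ))
  obtain ⟨w, hw⟩ : ∃ w, W = dominated n ρ w := ⟨_, hw'.trans (dominated_trans hρ' w').symm⟩
  let b : Ω → ℝ := fun x => (((toFin (p ξ)).val.rnDeriv ρ.val x).toReal) ^ ((n : ℝ)⁻¹)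
  have hbm : Measurable b := (Measure.measurable_rnDeriv _ _).ennreal_toReal.pow_const _
  have hN : MeasurableSet {x | b x = 0} := hbm (measurableSet_singleton 0)
  have hroot : root n (p ξ) = dominated n ρ (trans n _ _ hρ ((memLp_const (1 : ℝ)).toLp _)) :=
    (dominated_trans hρ _).symm
  have hb : trans n _ _ hρ ((memLp_const (1 : ℝ)).toLp _) =ᵐ[ρ.val] b := by
    filter_upwards [coeFn_trans n hρ ((memLp_const (1 : ℝ)).toLp _),
      transFun_congr n hρ (root_coeFn (n := n) (p ξ))] with x h1 h2
    rw [h1, h2, transFun, one_mul]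
  -- For `B` null under `p ξ`, the functional `x ↦ L^n(x, 1_B ρ^{1/n}, …)` is nonnegative on roots
  -- and zero at the root of `p ξ`. It is minimal there, hence vanishes on `W`; so `w = 0` almost
  -- everywhere on `{b = 0}`.
  have hint : ∀ B, MeasurableSet B → B ⊆ {x | b x = 0} → ∫ x in B, w x ∂ρ.val = 0 :=
    fun B hB hBN => by
    have hχm : MemLp (B.indicator fun _ => (1 : ℝ)) n ρ.val := (memLp_const 1).indicator hB
    have hχ := hχm.coeFn_toLp
    let y := dominated n ρ (hχm.toLp _)
    let Φ : RootSpace n Ω →L[ℝ] ℝ :=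
      (canonicalMultilinear Ω n).toContinuousLinearMap (fun _ => y) 0
    have hΦ0 : Φ (root n (p ξ)) = 0 := by
      change canonicalForm n (Function.update (fun _ => y) 0 (root n (p ξ))) = 0
      rw [hroot, canonicalForm_update_indicator hn ρ _ hB hχ,
        setIntegral_congr_ae (g := fun _ => 0) hB (by
          filter_upwards [hb] with x hx hxB
          rw [hx]; exact hBN hxB)]
      simp
    have h := fderiv_rootDeriv_eq_zero hp Φ.hasFDerivAt (fun η => by
      rw [hΦ0]
      refine canonicalForm_update_nonneg ?_ (p η)
      filter_upwards [hχ] with x hx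
      rw [hx]
      exact Set.indicator_nonneg (fun _ _ => zero_le_one) x) v
    rw [← hW, hw] at h
    have h' : (n : ℝ) ^ n * ∫ x in B, w x ∂ρ.val = 0 :=
      (canonicalForm_update_indicator hn ρ w hB hχ).symm.trans h
    exact (mul_eq_zero.mp h').resolve_left
      (pow_ne_zero _ (Nat.cast_ne_zero.mpr (NeZero.ne n)))
  have hwN : ∀ᵐ x ∂ρ.val, b x = 0 → w x = 0 := by
    refine (ae_restrict_iff' hN).mp ?_
    refine Integrable.ae_eq_zero_of_forall_setIntegral_eq_zero (integrable_coe w).integrableOn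
      fun B hB _ => ?_
    rw [Measure.restrict_restrict hB]
    exact hint _ (hB.inter hN) Set.inter_subset_right
  -- The coefficient of `W` with respect to `p ξ`. Where `b = 0` the quotient is `0`, which agrees
  -- with the vanishing of `w`.
  let φ : Ω → ℝ := fun x => w x / b x
  have hφm : StronglyMeasurable φ :=
    ((Lp.stronglyMeasurable w).measurable.div hbm).stronglyMeasurable
  have hφw : w =ᵐ[ρ.val] transFun n (toFin (p ξ)).val ρ.val φ := by
    filter_upwards [hwN] with x hx
    change w x = w x / b x * b x
    by_cases h : b x = 0
    · rw [hx h, zero_div, zero_mul]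
    · rw [div_mul_cancel₀ _ h]
  have hφ : MemLp φ n (toFin (p ξ)).val := by
    refine ⟨hφm.aestronglyMeasurable, ?_⟩
    rw [← eLpNorm_transFun n hρ hφm, ← eLpNorm_congr_ae hφw]
    exact Lp.eLpNorm_lt_top w
  have hWφ : dominated n (toFin (p ξ)) (hφ.toLp φ) = W := by
    rw [hw, dominated_toLp hρ hφ (Lp.memLp w) hφw, Lp.toLp_coeFn]
  refine ⟨hφ.toLp φ, ?_, hWφ⟩
  -- The function `x ↦ L^n(x, …, x)` equals `n^n` on all roots, so it too is minimal along the
  -- model; its derivative in direction `W` is `n · n^n ∫ φ dp(ξ)`.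
  have hD : HasFDerivAt (fun x : RootSpace n Ω => canonicalMultilinear Ω n fun _ => x)
      (((canonicalMultilinear Ω n).linearDeriv fun _ => root n (p ξ)).comp
        (ContinuousLinearMap.pi fun _ => ContinuousLinearMap.id ℝ (RootSpace n Ω)))
      (root n (p ξ)) :=
    ((canonicalMultilinear Ω n).hasFDerivAt (fun _ => root n (p ξ))).comp (root n (p ξ))
      (ContinuousLinearMap.pi fun _ => ContinuousLinearMap.id ℝ (RootSpace n Ω)).hasFDerivAt
  have h := fderiv_rootDeriv_eq_zero hp hD (fun η => by
    rw [canonicalMultilinear_apply, canonicalMultilinear_apply, canonicalForm_root,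
      canonicalForm_root]) v
  rw [← hW, ← hWφ, ContinuousLinearMap.comp_apply, ContinuousMultilinearMap.linearDeriv_apply] at h
  have h' : ∑ i : Fin n, (n : ℝ) ^ n * ∫ x, hφ.toLp φ x ∂(toFin (p ξ)).val = 0 :=
    (Finset.sum_congr rfl fun i _ =>
      (canonicalForm_update_root (p ξ) i (hφ.toLp φ)).symm).trans h
  rw [Finset.sum_const, Finset.card_univ, Fintype.card_fin, nsmul_eq_mul] at h'
  have hn0 : (n : ℝ) ≠ 0 := Nat.cast_ne_zero.mpr (NeZero.ne n)
  exact (mul_eq_zero.mp ((mul_eq_zero.mp h').resolve_left hn0)).resolve_left (pow_ne_zero _ hn0)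

end ModelTangency

/-! ### The classification and the main theorem -/

section Classification

variable {n : ℕ} [NeZero n]

/-- Congruent families of `n`-tensors on `P^{1/n}` are multiples of the canonical tensor, provided
permutation invariant `n`-forms on finite sets are multiples of `∑ ∏ f_i` on mean zero functions. -/
theorem exists_form_eq_canonicalForm
    (inv : ∀ (J : Type u) [Fintype J] [DecidableEq J]
      (M : MultilinearMap ℝ (fun _ : Fin n => J → ℝ) ℝ),
      (∀ (σ : Equiv.Perm J) (f : Fin n → J → ℝ), M (fun i => f i ∘ σ) = M f) →
      ∃ d, ∀ f : Fin n → J → ℝ, (∀ i, ∑ j, f i j = 0) → M f = d * ∑ j, ∏ i, f i j)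
    (hn : 2 + (-2 : ℝ) ^ n ≠ 0) {Θ : ∀ (Ω : Type u) [MeasurableSpace Ω], TensorField n Ω n}
    (hΘ : IsCongruentFamily Θ) :
    ∃ c : ℝ, ∀ (Ω : Type u) [MeasurableSpace Ω] (μ : ProbabilityMeasure Ω)
      (V : Fin n → tangent n μ),
      (Θ Ω).form μ V = c * canonicalForm n fun i => (V i : RootSpace n Ω) := by
  obtain ⟨c, hc⟩ := exists_agreesOnStep_uniformProb_forall inv hn hΘ
  exact ⟨c, fun Ω _ μ V => form_eq_canonicalForm (agreesOnStep hΘ hc) μ V⟩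

end Classification

end RootMeasure

end

theorem mainTheorem3 :
    (∀ Θ : ∀ (Ω : Type u) [MeasurableSpace Ω], RootMeasure.TensorField 2 Ω 2,
      RootMeasure.IsCongruentFamily Θ →
      ∃ c : ℝ,
        (∀ (Ω : Type u) [MeasurableSpace Ω] (μ : ProbabilityMeasure Ω)
          (V : Fin 2 → RootMeasure.tangent 2 μ),
          (Θ Ω).form μ V = c * RootMeasure.fisherMetric μ V) ∧
        (∀ (Ω : Type u) [MeasurableSpace Ω]
          (E : Type v) [NormedAddCommGroup E] [NormedSpace ℝ E]
          (H : Type w) [TopologicalSpace H] (I : ModelWithCorners ℝ E H)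
          (M : Type x) [TopologicalSpace M] [ChartedSpace H M] [IsManifold I 1 M]
          [BoundarylessManifold I M] (p : M → ProbabilityMeasure Ω),
          RootMeasure.IsIntegrableModel I 2 p →
          ∃ h : ∀ ξ v, RootMeasure.rootDeriv I 2 p ξ v ∈ RootMeasure.tangent 2 (p ξ),
            ∀ (ξ : M) (v : Fin 2 → TangentSpace I ξ),
              RootMeasure.modelPullback I p h (Θ Ω) ξ v =
                c * RootMeasure.modelTensor I 2 p ξ v)) ∧
    (∀ Θ : ∀ (Ω : Type u) [MeasurableSpace Ω], RootMeasure.TensorField 3 Ω 3,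
      RootMeasure.IsCongruentFamily Θ →
      ∃ c : ℝ,
        (∀ (Ω : Type u) [MeasurableSpace Ω] (μ : ProbabilityMeasure Ω)
          (V : Fin 3 → RootMeasure.tangent 3 μ),
          (Θ Ω).form μ V = c * RootMeasure.amariChentsov μ V) ∧
        (∀ (Ω : Type u) [MeasurableSpace Ω]
          (E : Type v) [NormedAddCommGroup E] [NormedSpace ℝ E]
          (H : Type w) [TopologicalSpace H] (I : ModelWithCorners ℝ E H)
          (M : Type x) [TopologicalSpace M] [ChartedSpace H M] [IsManifold I 1 M]
          [BoundarylessManifold I M] (p : M → ProbabilityMeasure Ω),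
          RootMeasure.IsIntegrableModel I 3 p →
          ∃ h : ∀ ξ v, RootMeasure.rootDeriv I 3 p ξ v ∈ RootMeasure.tangent 3 (p ξ),
            ∀ (ξ : M) (v : Fin 3 → TangentSpace I ξ),
              RootMeasure.modelPullback I p h (Θ Ω) ξ v =
                c * RootMeasure.modelTensor I 3 p ξ v)) := by
  refine ⟨fun Θ hΘ => ?_, fun Θ hΘ => ?_⟩
  · obtain ⟨c, hc⟩ := RootMeasure.exists_form_eq_canonicalForm
      (fun J _ _ M hM => RootMeasure.bilinear_of_perm_invariant M hM) (by norm_num) hΘ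
    -- Once tangency holds, both pullbacks are by definition values at the differentials of
    -- `p^{1/2}`, so the model statement is `hc` at `p ξ`.
    exact ⟨c, hc, fun Ω _ E _ _ H _ I M _ _ _ _ p hp =>
      ⟨fun ξ v => RootMeasure.rootDeriv_mem_tangent le_rfl (hp.mdifferentiable_root ξ) v,
        fun ξ v => hc Ω (p ξ) _⟩⟩
  · obtain ⟨c, hc⟩ := RootMeasure.exists_form_eq_canonicalForm
      (fun J _ _ M hM => RootMeasure.trilinear_of_perm_invariant M hM) (by norm_num) hΘ
    exact ⟨c, hc, fun Ω _ E _ _ H _ I M _ _ _ _ p hp =>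
      ⟨fun ξ v => RootMeasure.rootDeriv_mem_tangent (by norm_num) (hp.mdifferentiable_root ξ) v,
        fun ξ v => hc Ω (p ξ) _⟩⟩
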